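/- Let $u$ be a word (pattern). A value of $u$ is a word obtained from $u$ by substituting nonempty words for its letters, equal letters being replaced by equal words; a word contains a value of $u$ if some value of $u$ is a contiguous subword of it. The word $u$ is called blocking if over every finite alphabet only finitely many words contain no value of $u$, and non-blocking (avoidable) otherwise. It is $n$-avoidable if over the $n$-letter alphabet infinitely many words contain no value of $u$. Let $\alpha(u)$ be the number of distinct letters of $u$, and for non-blocking $u$ let $m(u)$ be the least $n$ such that $u$ is $n$-avoidable. **Theorem.** For every non-blocking word $u$, $$m(u)\le 2\alpha(u)+4 .$$ More precisely, let $k$ be whichever of $2\alpha(u)+2$, $2\alpha(u)+4$ is divisible by $4$. Then $u$ is $k$-avoidable. Moreover, suppose $\alpha(u)\ge 2$. In the symmetric group $S_k$ take the cycles $f_1=(1,3,5,\dots,k-1)$ and $g_1=(2,6,10,\dots,k-2)$, and let $v_1,\dots,v_k$ be the permutations $f_1,f_1^2,\dots,f_1^{k/2},\,g_1,g_1f_1,\dots,g_1f_1^{k/2-1}$, listed in any order. Let $\varphi_0$ be the $k$-uniform morphism on words over $\{x_1,\dots,x_k\}$ with $\varphi_0(x_i)=x_{v_i(1)}x_{v_i(2)}\cdots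 x_{v_i(k)}$, and put $J_1=\varphi_0(x_1)$, $J_m=\varphi_0(J_{m-1})$ for $m\ge 2$. Then no word $J_m$, $m\ge1$, contains a value of $u$. The bound improves the Baker–McNulty–Taylor bounds $m(u)<4(\alpha(u)+2)[\ln(\alpha(u)+2)]$ and $m(u)<9(\alpha(u)+20)$: for every non-blocking $u$, $2\alpha(u)+4$ is smaller than both right-hand sides, where $[\,\cdot\,]$ denotes the integer part. -/

import Mathlib

/-- The word `w` contains a value of the word (pattern) `u`: some assignment `φ` of nonempty words
to the letters of `u` turns `u` into a contiguous subword of `w`. -/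
def ContainsValue {V A : Type*} (u : List V) (w : List A) : Prop :=
  ∃ φ : V → List A, (∀ x ∈ u, φ x ≠ []) ∧ u.flatMap φ <:+: w

/-- `u` is blocking (unavoidable): over every finite alphabet only finitely many words contain
no value of `u`. -/
def IsBlocking {V : Type*} (u : List V) : Prop :=
  ∀ (A : Type) [Finite A], {w : List A | ¬ ContainsValue u w}.Finite

/-- `u` is `n`-avoidable: over the alphabet with `n` letters infinitely many words contain
no value of `u`. -/
def IsAvoidableOn {V : Type*} (u : List V) (n : ℕ) : Prop :=
  {w : List (Fin n) | ¬ ContainsValue u w}.Infinite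

/-- `m(u)`: the least `n` such that `u` is `n`-avoidable. -/
noncomputable def minAlphabet {V : Type*} (u : List V) : ℕ :=
  sInf {n : ℕ | IsAvoidableOn u n}

/-- `α(u)`: the number of distinct letters occurring in `u`. -/
noncomputable def numLetters {V : Type*} (u : List V) : ℕ :=
  {x : V | x ∈ u}.ncard

/-- The cycle `f₁ = (1, 3, 5, …, k-1)`; the element `i : Fin k` stands for the number `i + 1`. -/
def cycleF (k : ℕ) : Equiv.Perm (Fin k) :=
  ((List.finRange k).filter fun i => (i.val + 1) % 2 = 1).formPerm

/-- The cycle `g₁ = (2, 6, 10, …, k-2)` (for `k` divisible by 4);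
the element `i : Fin k` stands for the number `i + 1`. -/
def cycleG (k : ℕ) : Equiv.Perm (Fin k) :=
  ((List.finRange k).filter fun i => (i.val + 1) % 4 = 2).formPerm

/-- The list `f₁, f₁², …, f₁^(k/2), g₁, g₁f₁, …, g₁f₁^(k/2-1)` of `k` permutations. -/
def permList (k : ℕ) (i : Fin k) : Equiv.Perm (Fin k) :=
  if i.val < k / 2 then cycleF k ^ (i.val + 1) else cycleG k * cycleF k ^ (i.val - k / 2)

/-- The `k`-uniform morphism `x_i ↦ x_{v_i(1)} x_{v_i(2)} ⋯ x_{v_i(k)}` given by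
permutations `v_1, …, v_k`. -/
def permMorphism {k : ℕ} (v : Fin k → Equiv.Perm (Fin k)) (w : List (Fin k)) : List (Fin k) :=
  w.flatMap fun i => List.ofFn fun j => v i j

/-- The words `J_m`: the `m`-th image of the one-letter word `x_1` under the morphism, so that
`J_1` is the image of `x_1` and `J_m` is the image of `J_{m-1}`. -/
def iterWord {k : ℕ} (hk : 0 < k) (v : Fin k → Equiv.Perm (Fin k)) (m : ℕ) : List (Fin k) :=
  (permMorphism v)^[m] [⟨0, hk⟩]

/-! A word with a nonempty parse in the ruler sequence ν₂(1), ν₂(2), … is blocking: the prefix of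
length 2^n − 1 is the Zimin word on n letters, and Zimin words are unavoidable by pigeonhole
(`exists_zimin_value`, `IsParse.isBlocking`). So it suffices to turn a value of u in J_m into such a
parse.

This is done by induction on m. The word J_m consists of blocks, the images of the letters of
J_{m-1}, and one letter of every block serves as its marker. Replacing each piece of a parse by the
blocks whose markers it contains gives a parse in J_{m-1}, possibly with empty pieces. Conversely, a
ruler parse R' with the same nonempty pieces lifts to 2^G * R' + (label of the position relative to
the last marker); this is `IsParse.desubstitute`. Two things are needed: equal pieces with markers
determine the letters of the marked blocks, and equal pieces without markers have labels that spell
equal ruler factors.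

Number letters and positions from 0. Positions 3 mod 4 carry fixed letters, which reveal the
position modulo k; once it is known, a position 1 mod 4 reveals whether g₁ is applied and an even
position the power of f₁, so one of each identifies the block. A piece avoiding positions 3 mod 4
has length at most 3 and meets only the ruler letters 0 and 1, which its own letters determine.

A marker is harmful only if it is the sole odd letter in the piece of some pattern letter. If one of
3, 5, …, k-3 is harmless, it is used (`desubstitutes_three`, `desubstitutes_one`). Otherwise these
numbers occupy k/2 - 2 distinct letters of u; as α(u) ≤ k/2 - 1, at most one letter of u is left to
cover the numbers 1 and k-1, and then k-1 works (`desubstitutes_last`). The case α(u) = 1, k = 4 is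
settled by a square-free word. -/

/-! ### The ruler sequence and Zimin words -/

/-- The exponent of `2` in `n` only depends on `n` modulo a power of two not dividing `n`. -/
theorem padicValNat_two_congr {n n' G : ℕ} (h : n ≡ n' [MOD 2 ^ G]) (hn : ¬ 2 ^ G ∣ n) :
    padicValNat 2 n = padicValNat 2 n' := by
  have hn' : ¬ 2 ^ G ∣ n' := fun h' => hn ((h.dvd_iff dvd_rfl).2 h')
  have n0 : n ≠ 0 := by rintro rfl; simp at hn
  have n0' : n' ≠ 0 := by rintro rfl; simp at hn'
  have key : ∀ e ≤ G, (2 ^ e ∣ n ↔ 2 ^ e ∣ n') := fun e he => h.dvd_iff (pow_dvd_pow 2 he)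
  have lt : padicValNat 2 n < G := by
    by_contra hc
    exact hn ((padicValNat_dvd_iff_le n0).2 (not_lt.1 hc))
  have lt' : padicValNat 2 n' < G := by
    by_contra hc
    exact hn' ((padicValNat_dvd_iff_le n0').2 (not_lt.1 hc))
  apply le_antisymm
  · exact (padicValNat_dvd_iff_le n0').1 ((key _ lt.le).1 pow_padicValNat_dvd)
  · exact (padicValNat_dvd_iff_le n0).1 ((key _ lt'.le).2 pow_padicValNat_dvd)

theorem padicValNat_two_lt {n G : ℕ} (hn : ¬ 2 ^ G ∣ n) : padicValNat 2 n < G := by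
  have n0 : n ≠ 0 := by rintro rfl; simp at hn
  by_contra hc
  exact hn ((padicValNat_dvd_iff_le n0).2 (not_lt.1 hc))

theorem padicValNat_two_pow_mul {m G : ℕ} (hm : m ≠ 0) :
    padicValNat 2 (2 ^ G * m) = G + padicValNat 2 m := by
  rw [padicValNat.mul (by positivity) hm, padicValNat.prime_pow]

/-- The Zimin word on `n` letters: its letter in position `i` is the exponent of `2` in `i + 1`. -/
def zimin (n : ℕ) : List ℕ := (List.range (2 ^ n - 1)).map fun i => padicValNat 2 (i + 1)

/-- The middle letter is the exponent of 2 in 2^n; to the right of it, adding 2^n to a smaller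
positive number keeps its exponent. -/
theorem zimin_succ (n : ℕ) : zimin (n + 1) = zimin n ++ [n] ++ zimin n := by
  have h2 : 2 ^ (n + 1) - 1 = (2 ^ n - 1) + 1 + (2 ^ n - 1) := by
    have := Nat.one_le_two_pow (n := n); rw [pow_succ]; omega
  have h3 : 2 ^ n - 1 + 1 = 2 ^ n := by
    have := Nat.one_le_two_pow (n := n); omega
  unfold zimin
  rw [h2, List.range_add, List.range_add]
  simp only [List.map_append, List.map_map, List.range_one, List.map_cons, List.map_nil,
    Nat.add_zero, h3, padicValNat.prime_pow]
  congr 1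
  apply List.map_congr_left
  intro i hi
  rw [List.mem_range] at hi
  simp only [Function.comp]
  symm
  apply padicValNat_two_congr (G := n)
  · rw [Nat.add_assoc]; simp [Nat.ModEq]
  · intro hd
    have := Nat.le_of_dvd (by omega) hd
    omega

theorem lt_of_mem_zimin {n i : ℕ} (hi : i ∈ zimin n) : i < n := by
  simp only [zimin, List.mem_map, List.mem_range] at hi
  obtain ⟨j, hj, rfl⟩ := hi
  apply padicValNat_two_lt
  intro hd
  have := Nat.le_of_dvd (by omega) hd
  omega

/-- Zimin words are unavoidable. -/
theorem exists_zimin_value (A : Type) [Finite A] (n : ℕ) :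
    ∃ N : ℕ, ∀ w : List A, N ≤ w.length →
      ∃ ψ : ℕ → List A, (∀ i, ψ i ≠ []) ∧ (zimin n).flatMap ψ <:+: w := by
  classical
  induction n with
  | zero =>
    refine ⟨1, fun w hw => ⟨fun _ => w, fun _ h => ?_, ?_⟩⟩
    · simp [h] at hw
    · simp [zimin]
  | succ n ih =>
    obtain ⟨N, hN⟩ := ih
    have := Fintype.ofFinite A
    let C := Fintype.card (List.Vector A N)
    -- There is room for C + 1 windows of length N starting N + 1 apart, so two of them coincide and
    -- at least one letter lies between them.
    refine ⟨(N + 1) * (C + 1), fun w hw => ?_⟩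
    have hlen : ∀ i : Fin (C + 1), ((w.drop (i * (N + 1))).take N).length = N := by
      intro i
      have : (i : ℕ) * (N + 1) + (N + 1) ≤ (N + 1) * (C + 1) := by
        have := Nat.mul_le_mul_right (N + 1) (Nat.succ_le_of_lt i.2)
        rw [Nat.succ_mul] at this
        linarith
      rw [List.length_take, List.length_drop]
      omega
    obtain ⟨i, i', hne, heq⟩ := Fintype.exists_ne_map_eq_of_card_lt
      (β := List.Vector A N) (fun i : Fin (C + 1) => (⟨(w.drop (i * (N + 1))).take N, hlen i⟩ : List.Vector A N))
      (by rw [Fintype.card_fin]; exact Nat.lt_succ_self _)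
    wlog hlt : i < i' generalizing i i'
    · exact this i' i hne.symm heq.symm (lt_of_le_of_ne (not_lt.1 hlt) hne.symm)
    have heq' : (w.drop (i * (N + 1))).take N = (w.drop (i' * (N + 1))).take N :=
      congrArg Subtype.val heq
    obtain ⟨ψ, hψ, p, s, hps⟩ := hN _ (hlen i).ge
    have hgap : ∃ g, (i' : ℕ) * (N + 1) = i * (N + 1) + N + (g + 1) := by
      have := Nat.mul_le_mul_right (N + 1) (Nat.succ_le_of_lt (Fin.lt_def.1 hlt))
      rw [Nat.succ_mul] at this
      exact ⟨i' * (N + 1) - i * (N + 1) - N - 1, by omega⟩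
    obtain ⟨g, hg⟩ := hgap
    set b := (w.drop (i * (N + 1))).take N with hb
    set mid := ((w.drop (i * (N + 1))).drop N).take (g + 1) with hmid
    have hw' : w = w.take (i * (N + 1)) ++ (b ++ (mid ++ (b ++
        (w.drop (i' * (N + 1))).drop N))) := by
      have e1 := List.take_append_drop (i * (N + 1)) w
      have e2 : b ++ (w.drop (i * (N + 1))).drop N = w.drop (i * (N + 1)) :=
        List.take_append_drop N (w.drop (i * (N + 1)))
      have e3 : mid ++ w.drop (i' * (N + 1)) = (w.drop (i * (N + 1))).drop N := by
        have := List.take_append_drop (g + 1) ((w.drop (i * (N + 1))).drop N)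
        rwa [List.drop_drop (i := g + 1), List.drop_drop (i := N + (g + 1)), ← hmid, ← add_assoc,
          ← hg] at this
      have e4 : b ++ (w.drop (i' * (N + 1))).drop N = w.drop (i' * (N + 1)) := by
        rw [heq']; exact List.take_append_drop N (w.drop (i' * (N + 1)))
      rw [e4, e3, e2, e1]
    have hZ : ∀ ρ : List A, (zimin n).flatMap (Function.update ψ n ρ) = (zimin n).flatMap ψ := by
      intro ρ
      apply List.flatMap_congr
      intro j hj
      rw [Function.update_of_ne (lt_of_mem_zimin hj).ne]
    have hmidne : mid ≠ [] := by
      intro h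
      have h1 : mid.length = 0 := by rw [h]; rfl
      have h2 := (hlen i')
      rw [List.length_take, List.length_drop] at h2
      rw [hmid, List.length_take, List.length_drop, List.length_drop] at h1
      have : (i' : ℕ) * (N + 1) + (N + 1) ≤ (N + 1) * (C + 1) := by
        have := Nat.mul_le_mul_right (N + 1) (Nat.succ_le_of_lt i'.2)
        rw [Nat.succ_mul] at this
        linarith
      omega
    -- The window is p Z s with Z a value of the smaller Zimin word, so two copies read p Z (s mid
    -- p) Z s, and the bracket is the value of the new letter.
    refine ⟨Function.update ψ n (s ++ mid ++ p), ?_, ?_⟩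
    · intro j
      by_cases hj : j = n
      · subst hj; simp [hmidne]
      · rw [Function.update_of_ne hj]; exact hψ j
    · rw [zimin_succ, List.flatMap_append, List.flatMap_append, hZ]
      refine ⟨w.take (i * (N + 1)) ++ p, s ++ (w.drop (i' * (N + 1))).drop N, ?_⟩
      conv_rhs => rw [hw', ← hps]
      simp

/-! ### Parses and their desubstitution -/

/-- `B` cuts a factor of the infinite word `c` into consecutive pieces, one for every letter of
`u`, equal letters getting equal pieces; pieces may be empty. -/
def IsParse {V A : Type*} (u : List V) (c : ℕ → A) (B : ℕ → ℕ) : Prop :=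
  ∀ j j' x, u[j]? = some x → u[j']? = some x →
    ∃ l, B (j + 1) = B j + l ∧ B (j' + 1) = B j' + l ∧ ∀ i < l, c (B j + i) = c (B j' + i)

theorem IsParse.mono {V A : Type*} {u : List V} {c : ℕ → A} {B : ℕ → ℕ} (h : IsParse u c B)
    {j j' : ℕ} (hjj : j ≤ j') (hj' : j' ≤ u.length) : B j ≤ B j' := by
  induction j', hjj using Nat.le_induction with
  | base => exact le_rfl
  | succ i hi ih =>
    obtain ⟨l, hl, -⟩ := h i i u[i] (by simp) (by simp)
    have := ih (by omega)
    omega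

theorem flatMap_eq_map_range' {V A : Type*} (c : ℕ → A) (φ : V → List A) :
    ∀ (u : List V) (B : ℕ → ℕ),
      (∀ j x, u[j]? = some x → B j ≤ B (j + 1) ∧
        φ x = (List.range' (B j) (B (j + 1) - B j)).map c) →
      B 0 ≤ B u.length ∧
      u.flatMap φ = (List.range' (B 0) (B u.length - B 0)).map c
  | [], B, _ => by simp
  | x :: u, B, h => by
    obtain ⟨h1, h2⟩ := flatMap_eq_map_range' c φ u (fun j => B (j + 1))
      (fun j y hy => h (j + 1) y (by simpa using hy))
    obtain ⟨h3, h4⟩ := h 0 x (by simp)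
    simp only [zero_add] at h1 h2 h3 h4
    refine ⟨h3.trans h1, ?_⟩
    rw [List.flatMap_cons, h2, h4, ← List.map_append, List.length_cons]
    congr 1
    have := List.range'_append (s := B 0) (m := B 1 - B 0) (n := B (u.length + 1) - B 1) (step := 1)
    rw [show B 0 + 1 * (B 1 - B 0) = B 1 by omega] at this
    rw [this]
    congr 1
    omega

/-- A word that has a nonempty parse in the ruler sequence is unavoidable. -/
theorem IsParse.isBlocking {V : Type*} {u : List V} {R : ℕ → ℕ}
    (h : IsParse u (fun p => padicValNat 2 (p + 1)) R)
    (hlive : ∀ j < u.length, R j < R (j + 1)) : IsBlocking u := by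
  classical
  intro A _
  obtain ⟨N, hN⟩ := exists_zimin_value A (R u.length)
  refine (List.finite_length_lt A N).subset fun w hw => ?_
  by_contra hlt
  simp only [Set.mem_ofPred_eq, not_lt] at hlt
  apply hw
  obtain ⟨ψ, hψ, hinf⟩ := hN w hlt
  let c : ℕ → ℕ := fun p => padicValNat 2 (p + 1)
  let φ : V → List ℕ := fun x =>
    (List.range' (R (u.idxOf x)) (R (u.idxOf x + 1) - R (u.idxOf x))).map c
  have hidx : ∀ (j : ℕ) (x : V), u[j]? = some x → u[u.idxOf x]? = some x := by
    intro j x hx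
    have hm : x ∈ u := List.mem_of_getElem? hx
    rw [List.getElem?_eq_getElem (List.idxOf_lt_length_of_mem hm)]
    simp
  obtain ⟨h0, hflat⟩ := flatMap_eq_map_range' c φ u R (by
    intro j x hx
    obtain ⟨l, h1, h2, h3⟩ := h j (u.idxOf x) x hx (hidx j x hx)
    refine ⟨by omega, ?_⟩
    simp only [φ, h1, h2, Nat.add_sub_cancel_left, List.range'_eq_map_range, List.map_map]
    apply List.map_congr_left
    intro i hi
    exact (h3 i (List.mem_range.1 hi)).symm)
  -- Values compose: u maps to a factor of a Zimin word, which in turn maps into `w`.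
  refine ⟨fun x => (φ x).flatMap ψ, ?_, ?_⟩
  · intro x hx hnil
    obtain ⟨j, hj, hjx⟩ := List.getElem_of_mem hx
    have hlt := hlive (u.idxOf x) (List.idxOf_lt_length_of_mem hx)
    have : R (u.idxOf x) ∈ List.range' (R (u.idxOf x)) (R (u.idxOf x + 1) - R (u.idxOf x)) := by
      simp [List.mem_range']; omega
    rw [List.flatMap_eq_nil_iff] at hnil
    exact hψ _ (hnil _ (List.mem_map_of_mem this))
  · rw [← List.flatMap_assoc, hflat]
    refine List.IsInfix.trans ?_ hinf
    have hle : R u.length ≤ 2 ^ R u.length - 1 := by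
      have := Nat.lt_two_pow_self (n := R u.length); omega
    have hz : (List.range' (R 0) (R u.length - R 0)).map c <:+: zimin (R u.length) := by
      unfold zimin
      apply List.IsInfix.map
      refine ⟨List.range (R 0), List.range' (R u.length) (2 ^ R u.length - 1 - R u.length), ?_⟩
      have e1 := List.range'_append (s := 0) (m := R 0) (n := R u.length - R 0) (step := 1)
      have e2 := List.range'_append (s := 0) (m := R u.length)
        (n := 2 ^ R u.length - 1 - R u.length) (step := 1)
      simp only [zero_add, one_mul] at e1 e2
      rw [List.range_eq_range', List.range_eq_range', e1, Nat.add_sub_cancel' h0, e2,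
        Nat.add_sub_cancel' hle]
    obtain ⟨p, s, hps⟩ := hz
    exact ⟨p.flatMap ψ, s.flatMap ψ, by rw [← hps]; simp⟩

/-- Two equal pieces of the text, at `[a, b)` and `[a', b')`, contain no block marker (`β` counts
the markers), and the labels `lam` send them to equal nonempty factors of the ruler sequence. -/
def GapPair (β lam : ℕ → ℕ) (a b a' b' : ℕ) : Prop :=
  β b = β a ∧ β b' = β a' ∧ ∃ m, 0 < m ∧ lam b = lam a + m ∧ lam b' = lam a' + m ∧
    ∀ i < m, padicValNat 2 (lam a + i + 1) = padicValNat 2 (lam a' + i + 1)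

/-- Two equal pieces of the text, at `[a, b)` and `[a', b')`, have equal labels at their ends, and
the blocks whose markers they contain carry the same letters of `d`. -/
def BlockPair {A : Type*} (d : ℕ → A) (β lam : ℕ → ℕ) (a b a' b' : ℕ) : Prop :=
  lam a = lam a' ∧ lam b = lam b' ∧ ∃ m, 0 < m ∧ β b = β a + m ∧ β b' = β a' + m ∧
    ∀ i < m, d (β a + i) = d (β a' + i)

theorem padicValNat_two_block {G m m' r : ℕ} (hr : r % 2 ^ G ≠ 0) :
    padicValNat 2 (2 ^ G * m + r) = padicValNat 2 (2 ^ G * m' + r) := by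
  have hG := Nat.two_pow_pos G
  apply padicValNat_two_congr (G := G)
  · simp [Nat.ModEq]
  · rw [Nat.dvd_iff_mod_eq_zero]
    simpa using hr

/-- Desubstitution of a parse, and the reverse passage for parses in the ruler sequence. -/
theorem IsParse.desubstitute {V A A' : Type*} {u : List V} {c : ℕ → A} {d : ℕ → A'} {B : ℕ → ℕ}
    {β lam : ℕ → ℕ} {G : ℕ} (hB : IsParse u c B) (hlam : ∀ p, lam p < 2 ^ G)
    (H : ∀ (j j' : ℕ) (x : V), u[j]? = some x → u[j']? = some x → B j < B (j + 1) →
      GapPair β lam (B j) (B (j + 1)) (B j') (B (j' + 1)) ∨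
      BlockPair d β lam (B j) (B (j + 1)) (B j') (B (j' + 1))) :
    IsParse u d (fun j => β (B j)) ∧
    ∀ R', IsParse u (fun p => padicValNat 2 (p + 1)) R' →
      (∀ j < u.length, (R' j < R' (j + 1) ↔ β (B j) < β (B (j + 1)))) →
      ∃ R, IsParse u (fun p => padicValNat 2 (p + 1)) R ∧
        ∀ j < u.length, (R j < R (j + 1) ↔ B j < B (j + 1)) := by
  have live : ∀ (j j' : ℕ) (x : V), u[j]? = some x → u[j']? = some x →
      (B (j + 1) = B j ∧ B (j' + 1) = B j') ∨ (B j < B (j + 1)) := by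
    intro j j' x hj hj'
    obtain ⟨l, h1, h2, -⟩ := hB j j' x hj hj'
    omega
  have lt_len : ∀ (j : ℕ) (x : V), u[j]? = some x → j < u.length := fun j x h =>
    (List.getElem?_eq_some_iff.1 h).1
  refine ⟨?_, ?_⟩
  · intro j j' x hj hj'
    rcases live j j' x hj hj' with ⟨h, h'⟩ | hlt
    · exact ⟨0, by simp [h], by simp [h'], by simp⟩
    · rcases H j j' x hj hj' hlt with ⟨h1, h2, -⟩ | ⟨-, -, m, -, h1, h2, h3⟩
      · exact ⟨0, by simp [h1], by simp [h2], by simp⟩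
      · exact ⟨m, h1, h2, h3⟩
  · intro R' hR' hsupp
    have still : ∀ (j : ℕ) (x : V), u[j]? = some x → β (B (j + 1)) = β (B j) →
        R' (j + 1) = R' j := by
      intro j x hj hβ
      have h1 := hsupp j (lt_len j x hj)
      obtain ⟨l, h2, -, -⟩ := hR' j j x hj hj
      rw [hβ] at h1
      simp only [lt_irrefl, iff_false] at h1
      omega
    -- Each ruler letter of the coarse parse is blown up to a stretch of length 2^G, inside which
    -- the label gives the place.
    refine ⟨fun j => 2 ^ G * R' j + lam (B j), ?_, ?_⟩
    · intro j j' x hj hj'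
      rcases live j j' x hj hj' with ⟨h, h'⟩ | hlt
      · refine ⟨0, ?_, ?_, by simp⟩
        · simp [still j x hj (by rw [h]), h]
        · simp [still j' x hj' (by rw [h']), h']
      rcases H j j' x hj hj' hlt with ⟨h1, h2, m, hm, h3, h4, h5⟩ | ⟨h1, h2, m, hm, h3, h4, -⟩
      · refine ⟨m, ?_, ?_, ?_⟩
        · simp only [still j x hj h1, h3, add_assoc]
        · simp only [still j' x hj' h2, h4, add_assoc]
        · intro i hi
          have hb := hlam (B (j + 1))
          have hb' := hlam (B (j' + 1))
          have e1 : padicValNat 2 (2 ^ G * R' j + (lam (B j) + i + 1)) =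
              padicValNat 2 (2 ^ G * 0 + (lam (B j) + i + 1)) := by
            apply padicValNat_two_block; rw [Nat.mod_eq_of_lt (by omega)]; omega
          have e2 : padicValNat 2 (2 ^ G * R' j' + (lam (B j') + i + 1)) =
              padicValNat 2 (2 ^ G * 0 + (lam (B j') + i + 1)) := by
            apply padicValNat_two_block; rw [Nat.mod_eq_of_lt (by omega)]; omega
          simp only [mul_zero, zero_add, ← add_assoc] at e1 e2
          simp only [e1, e2, h5 i hi]
      · obtain ⟨l, hl1, hl2, hl3⟩ := hR' j j' x hj hj'
        have hl : 0 < l := by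
          have := (hsupp j (lt_len j x hj)).2 (by omega)
          omega
        have hla := hlam (B j)
        have hlb := hlam (B (j + 1))
        -- Labels are below 2^G, so one coarse step outweighs any drop of the label, and the
        -- subtraction in the next witness is genuine.
        have hGl : 2 ^ G ≤ 2 ^ G * l := Nat.le_mul_of_pos_right _ hl
        refine ⟨2 ^ G * l + lam (B (j + 1)) - lam (B j), ?_, ?_, ?_⟩
        · simp only [hl1, mul_add]; omega
        · simp only [hl2, mul_add, ← h2, ← h1]; omega
        · intro i hi
          set n := lam (B j) + i + 1 with hn
          have goal : padicValNat 2 (2 ^ G * R' j + n) = padicValNat 2 (2 ^ G * R' j' + n) := by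
            -- At multiples of 2^G the exponent is G plus a ruler letter of the coarse piece;
            -- elsewhere it does not depend on the coarse position.
            by_cases hr : n % 2 ^ G = 0
            · obtain ⟨e, he⟩ := Nat.dvd_of_mod_eq_zero hr
              have he0 : 0 < e := by
                rcases Nat.eq_zero_or_pos e with h | h
                · rw [h] at he; omega
                · exact h
              have hel : e ≤ l := by
                by_contra hc
                have := Nat.mul_le_mul_left (2 ^ G) (Nat.succ_le_of_lt (not_le.1 hc))
                rw [Nat.mul_succ] at this
                omega
              rw [he, ← mul_add, ← mul_add, padicValNat_two_pow_mul (by omega),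
                padicValNat_two_pow_mul (by omega)]
              have := hl3 (e - 1) (by omega)
              simp only [add_assoc, Nat.sub_add_cancel he0] at this
              rw [this]
            · exact padicValNat_two_block hr
          rw [hn] at goal
          simp only [← add_assoc] at goal
          simp only [← h1]
          exact goal
    · intro j hj
      have hx : u[j]? = some u[j] := List.getElem?_eq_getElem hj
      rcases live j j _ hx hx with ⟨h, -⟩ | hlt
      · simp [still j _ hx (by rw [h]), h]
      · refine iff_of_true ?_ hlt
        rcases H j j _ hx hx hlt with ⟨h1, -, m, hm, h3, -⟩ | ⟨-, -, m, hm, h3, -⟩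
        · simp only [still j _ hx h1, h3]; omega
        · have h4 := (hsupp j hj).2 (by omega)
          have := Nat.mul_le_mul_left (2 ^ G) (Nat.succ_le_of_lt h4)
          rw [Nat.mul_succ] at this
          have := hlam (B j)
          dsimp only
          omega

/-! ### Block texts and markers in a fixed position -/

/-- What is needed about a text `c` obtained from `d` by the morphism: letters at even positions
are shifted within a block, letters at positions `≡ 1 (mod 4)` are shifted by `4` or not,
according to the flag `fl` of the letter of the block, letters at positions `≡ 3 (mod 4)` are fixed;
the shift at the even positions together with the flag determines the letter of the block. -/
structure IsBlockText (k : ℕ) (fl : Fin k → ℕ) (d c : ℕ → Fin k) : Prop where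
  dvd : 4 ∣ k
  le : 8 ≤ k
  flag_le : ∀ x, fl x ≤ 1
  even : ∀ p, p % 2 = 0 → (c p).val % 2 = 0
  one : ∀ p, p % 4 = 1 → (c p).val = (p % k + 4 * fl (d (p / k))) % k
  three : ∀ p, p % 4 = 3 → (c p).val = p % k
  decode : ∀ p p', p % 2 = 0 → p % k = p' % k → c p = c p' →
    fl (d (p / k)) = fl (d (p' / k)) → d (p / k) = d (p' / k)

namespace IsBlockText

variable {k : ℕ} {fl : Fin k → ℕ} {d c : ℕ → Fin k}

theorem mod_four (T : IsBlockText k fl d c) {p : ℕ} (hp : p % 2 = 1) :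
    (c p).val % 4 = p % 4 := by
  have h4 : p % k % 4 = p % 4 := Nat.mod_mod_of_dvd p T.dvd
  rcases (by omega : p % 4 = 1 ∨ p % 4 = 3) with h | h
  · rw [T.one p h, Nat.mod_mod_of_dvd _ T.dvd]; omega
  · rw [T.three p h, h4]

theorem mod_two (T : IsBlockText k fl d c) (p : ℕ) : (c p).val % 2 = p % 2 := by
  rcases Nat.mod_two_eq_zero_or_one p with h | h
  · rw [T.even p h, h]
  · have := T.mod_four h; omega

theorem mod_four_iff (T : IsBlockText k fl d c) (p : ℕ) {r : ℕ} (hr : r % 2 = 1) :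
    (c p).val % 4 = r ↔ p % 4 = r := by
  have h2 := T.mod_two p
  rcases Nat.mod_two_eq_zero_or_one p with h | h
  · omega
  · rw [T.mod_four h]

theorem mod_four_congr (T : IsBlockText k fl d c) {p p' r : ℕ} (h : c p = c p') (hr : r % 2 = 1)
    (hp : p % 4 = r) : p' % 4 = r := by
  rw [← T.mod_four_iff p' hr, ← h, T.mod_four_iff p hr]
  exact hp

/-- Equal letters of the text at positions congruent to `1` modulo `4` and congruent modulo `k`
lie in blocks with equal flags. -/
theorem flag_eq (T : IsBlockText k fl d c) {p p' : ℕ} (h1 : p % 4 = 1) (hk : p % k = p' % k)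
    (h : c p = c p') : fl (d (p / k)) = fl (d (p' / k)) := by
  have h1' := T.mod_four_congr h (by norm_num) h1
  have e := congrArg Fin.val h
  rw [T.one p h1, T.one p' h1', ← hk] at e
  have h0 := T.flag_le (d (p / k))
  have h0' := T.flag_le (d (p' / k))
  have hlt : p % k < k := Nat.mod_lt _ (by have := T.le; omega)
  have := T.le
  have hm : ∀ f, f ≤ 1 → (p % k + 4 * f) % k = if p % k + 4 * f < k then p % k + 4 * f
      else p % k + 4 * f - k := by
    intro f hf
    split_ifs with hc
    · exact Nat.mod_eq_of_lt hc
    · rw [Nat.mod_eq_sub_mod (by omega), Nat.mod_eq_of_lt (by omega)]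
  rw [hm _ h0, hm _ h0'] at e
  split_ifs at e <;> omega

/-- The letter of a block is determined by two neighbouring letters of the block, if their position
is known. -/
theorem block_eq (T : IsBlockText k fl d c) {β β' r s : ℕ} (hr : r < k) (hs : s < k)
    (hr1 : r % 4 = 1) (hs2 : s % 2 = 0) (h1 : c (k * β + r) = c (k * β' + r))
    (h2 : c (k * β + s) = c (k * β' + s)) : d β = d β' := by
  have hk : 0 < k := by omega
  have e : ∀ (β r : ℕ), r < k → (k * β + r) / k = β ∧ (k * β + r) % k = r := fun β r hr => by
    rw [Nat.mul_add_div hk, Nat.div_eq_of_lt hr, Nat.mul_add_mod, Nat.mod_eq_of_lt hr]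
    exact ⟨rfl, rfl⟩
  have k4 : ∀ β, k * β % 4 = 0 := fun β => Nat.mod_eq_zero_of_dvd (T.dvd.mul_right β)
  have f1 := T.flag_eq (by have := k4 β; omega) (by rw [(e β r hr).2, (e β' r hr).2]) h1
  rw [(e β r hr).1, (e β' r hr).1] at f1
  have f2 := T.decode _ _ (by have := k4 β; omega) (by rw [(e β s hs).2, (e β' s hs).2]) h2
  rw [(e β s hs).1, (e β' s hs).1] at f2
  exact f2 f1

/-- Equal factors containing a position congruent to `3` modulo `4` start at positions congruent
modulo `k`. -/
theorem mod_eq_of_three (T : IsBlockText k fl d c) {a a' l i : ℕ}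
    (hm : ∀ i < l, c (a + i) = c (a' + i)) (hi : i < l) (h3 : (a + i) % 4 = 3) :
    a ≡ a' [MOD k] := by
  have h3' := T.mod_four_congr (hm i hi) (by norm_num) h3
  have e := congrArg Fin.val (hm i hi)
  rw [T.three _ h3, T.three _ h3'] at e
  exact Nat.ModEq.add_right_cancel' i e

/-- Away from positions 3 mod 4 the ruler letter is 0 at even positions and 1 at positions 1 mod 4,
and the letter of the text tells which of these holds. -/
theorem padicValNat_two_eq_of_ne_three (T : IsBlockText k fl d c) {a a' x x' i : ℕ}
    (h : c (a + i) = c (a' + i)) (h3 : (a + i) % 4 ≠ 3) (hx : x % 4 = a % 4)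
    (hx' : x' % 4 = a' % 4) : padicValNat 2 (x + i + 1) = padicValNat 2 (x' + i + 1) := by
  rcases Nat.mod_two_eq_zero_or_one (a + i) with h0 | h1
  · have h0' : (a' + i) % 2 = 0 := by rw [← T.mod_two, ← h, T.mod_two, h0]
    apply padicValNat_two_congr (G := 1)
    · simp only [Nat.ModEq, pow_one]; omega
    · omega
  · have e := T.mod_four_congr h (r := 1) (by norm_num) (by omega)
    apply padicValNat_two_congr (G := 2)
    · simp only [Nat.ModEq]; omega
    · omega

/-- The alternative required for desubstitution when every block is marked by its fixed letter in
position `k - s - 1`. -/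
theorem gap_or_block (T : IsBlockText k fl d c) {A : Type*} {d' : ℕ → A} {s a a' l : ℕ}
    (hs : 4 ∣ s) (hl : 0 < l) (hm : ∀ i < l, c (a + i) = c (a' + i))
    (dec : a ≡ a' [MOD k] → ∀ i, (a + s) / k + i < (a + l + s) / k →
      d' ((a + s) / k + i) = d' ((a' + s) / k + i)) :
    GapPair (fun p => (p + s) / k) (fun p => (p + s) % k) a (a + l) a' (a' + l) ∨
    BlockPair d' (fun p => (p + s) / k) (fun p => (p + s) % k) a (a + l) a' (a' + l) := by
  have hk : 0 < k := by have := T.le; omega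
  -- If such a position exists, the starts agree modulo k, so the end labels agree. If not, both
  -- factors lie strictly between consecutive positions 3 mod 4 and meet no marker.
  by_cases h3 : ∃ i < l, (a + i) % 4 = 3
  · obtain ⟨i, hi, h3⟩ := h3
    have hmod := T.mod_eq_of_three hm hi h3
    have ea : (a + s) % k = (a' + s) % k := hmod.add_right s
    have eb : (a + l + s) % k = (a' + l + s) % k := (hmod.add_right l).add_right s
    have d1 := Nat.div_add_mod (a + s) k
    have d2 := Nat.div_add_mod (a' + s) k
    have d3 := Nat.div_add_mod (a + l + s) k
    have d4 := Nat.div_add_mod (a' + l + s) k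
    have eβ : (a + l + s) / k + (a' + s) / k = (a' + l + s) / k + (a + s) / k := by
      apply Nat.eq_of_mul_eq_mul_left hk
      rw [mul_add, mul_add]; omega
    have hle : (a + s) / k ≤ (a + l + s) / k := Nat.div_le_div_right (by omega)
    rcases hle.eq_or_lt with h0 | h0
    · left
      rw [← h0] at d3
      refine ⟨h0.symm, by dsimp only; omega, l, hl, by dsimp only; omega, ?_, ?_⟩
      · have : (a' + l + s) / k = (a' + s) / k := by omega
        rw [this] at d4
        dsimp only; omega
      · intro i _
        dsimp only
        rw [ea]
    · right
      refine ⟨ea, eb, (a + l + s) / k - (a + s) / k, by omega, by dsimp only; omega,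
        by dsimp only; omega, fun i hi => dec hmod i (by omega)⟩
  · left
    push Not at h3
    have h4 : ∀ p, (p + s) % k % 4 = p % 4 := fun p => by
      rw [Nat.mod_mod_of_dvd _ T.dvd]; obtain ⟨t, rfl⟩ := hs; omega
    have hlen : a % 4 + l ≤ 3 := by
      by_contra hc
      exact h3 (3 - a % 4) (by omega) (by omega)
    have hlen' : a' % 4 + l ≤ 3 := by
      by_contra hc
      by_cases h3' : ∃ i < l, (a' + i) % 4 = 3
      · obtain ⟨i, hi, h3'⟩ := h3'
        exact h3 i hi (T.mod_four_congr (hm i hi).symm (by norm_num) h3')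
      · push Not at h3'
        exact h3' (3 - a' % 4) (by omega) (by omega)
    have adv : ∀ p, p % 4 + l ≤ 3 → (p + l + s) / k = (p + s) / k ∧
        (p + l + s) % k = (p + s) % k + l := by
      intro p hp
      have h5 := h4 p
      have h6 : (p + s) % k < k := Nat.mod_lt _ hk
      have h7 : (p + s) % k + l < k := by obtain ⟨q, hq⟩ := T.dvd; omega
      have d1 := Nat.div_add_mod (p + s) k
      have e : p + l + s = k * ((p + s) / k) + ((p + s) % k + l) := by omega
      rw [e, Nat.mul_add_div hk, Nat.mul_add_mod, Nat.div_eq_of_lt h7, Nat.mod_eq_of_lt h7]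
      exact ⟨rfl, rfl⟩
    refine ⟨(adv a hlen).1, (adv a' hlen').1, l, hl, (adv a hlen).2, (adv a' hlen').2, ?_⟩
    intro i hi
    exact T.padicValNat_two_eq_of_ne_three (hm i hi) (h3 i hi) (h4 a) (h4 a')

end IsBlockText

/-! ### Markers whose position depends on the flag -/

/-- The number of occurrences before `p` of the letter `4i + 1` of the text: every block contains
one, in an offset given by the flag of its letter. -/
def evenCount {k : ℕ} (fl : Fin k → ℕ) (d : ℕ → Fin k) (i p : ℕ) : ℕ :=
  p / k + if 4 * (i - fl (d (p / k))) + 1 < p % k then 1 else 0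

/-- The label of the position `p` relative to the preceding occurrence of `4i + 1`. -/
def evenLabel {k : ℕ} (fl : Fin k → ℕ) (d : ℕ → Fin k) (i p : ℕ) : ℕ :=
  let m := if 4 * (i - fl (d (p / k))) + 1 < p % k then p % k + 4 - 4 * i
    else p % k + k + 4 - 4 * i
  if k ≤ m then m + k else m

namespace IsBlockText

variable {k : ℕ} {fl : Fin k → ℕ} {d c : ℕ → Fin k}

/-- All that is needed about the count and the label of a position. -/
theorem even_spec (T : IsBlockText k fl d c) {i : ℕ} (hi : 1 ≤ i) (hik : 4 * i < k) (p : ℕ) :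
    ∃ o m, evenCount fl d i p = p / k + o ∧
      evenLabel fl d i p = (if k ≤ m then m + k else m) ∧
      (o = 0 ∧ m + 4 * i = p % k + k + 4 ∧ p % k ≤ 4 * (i - fl (d (p / k))) + 1 ∨
        o = 1 ∧ m + 4 * i = p % k + 4 ∧ 4 * (i - fl (d (p / k))) + 1 < p % k) ∧ m ≤ k + 5 := by
  have hlt : p % k < k := Nat.mod_lt _ (by omega)
  have hf := T.flag_le (d (p / k))
  by_cases h : 4 * (i - fl (d (p / k))) + 1 < p % k
  · exact ⟨1, p % k + 4 - 4 * i, by simp [evenCount, h], by simp [evenLabel, h], by omega, by omega⟩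
  · exact ⟨0, p % k + k + 4 - 4 * i, by simp [evenCount, h], by simp [evenLabel, h],
      by omega, by omega⟩

theorem evenLabel_lt (T : IsBlockText k fl d c) {i : ℕ} (hi : 1 ≤ i) (hik : 4 * i < k) (p : ℕ) :
    evenLabel fl d i p < 2 * k + 6 := by
  obtain ⟨o, m, -, h, -, hm⟩ := T.even_spec hi hik p
  rw [h]; split_ifs <;> omega

theorem evenLabel_mod_four (T : IsBlockText k fl d c) {i : ℕ} (hi : 1 ≤ i) (hik : 4 * i < k)
    (p : ℕ) : evenLabel fl d i p % 4 = p % 4 := by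
  obtain ⟨o, m, -, h, hm, -⟩ := T.even_spec hi hik p
  have h4 : p % k % 4 = p % 4 := Nat.mod_mod_of_dvd p T.dvd
  obtain ⟨q, hq⟩ := T.dvd
  rw [h]; split_ifs <;> omega

/-- The letter `4i + 1` of a block. -/
theorem even_letter (T : IsBlockText k fl d c) {i : ℕ} (hi : 1 ≤ i) (hik : 4 * i < k) (γ : ℕ) :
    (c (k * γ + (4 * (i - fl (d γ)) + 1))).val = 4 * i + 1 := by
  have hf := T.flag_le (d γ)
  have hk4 : k * γ % 4 = 0 := Nat.mod_eq_zero_of_dvd (T.dvd.mul_right γ)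
  obtain ⟨q, hq⟩ := T.dvd
  have hlt : 4 * (i - fl (d γ)) + 1 < k := by omega
  rw [T.one _ (by omega), Nat.mul_add_div (by omega), Nat.div_eq_of_lt hlt, Nat.mul_add_mod,
    Nat.mod_eq_of_lt hlt, add_zero,
    show 4 * (i - fl (d γ)) + 1 + 4 * fl (d γ) = 4 * i + 1 by omega]
  exact Nat.mod_eq_of_lt (by omega)

/-- Inside a block and away from the letter `4i + 1`, count and label are as expected. -/
theorem even_advance (T : IsBlockText k fl d c) {i : ℕ} (hi : 1 ≤ i) (hik : 4 * i < k) {a l : ℕ}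
    (hl : a % 4 + l ≤ 3) (hc : ∀ j < l, (c (a + j)).val ≠ 4 * i + 1) :
    evenCount fl d i (a + l) = evenCount fl d i a ∧
    evenLabel fl d i (a + l) = evenLabel fl d i a + l := by
  have hk : 0 < k := by omega
  obtain ⟨o, m, h1, h2, h3, -⟩ := T.even_spec hi hik a
  obtain ⟨o', m', h1', h2', h3', -⟩ := T.even_spec hi hik (a + l)
  have h4 : a % k % 4 = a % 4 := Nat.mod_mod_of_dvd a T.dvd
  have hlt : a % k < k := Nat.mod_lt _ hk
  have hlt' : a % k + l < k := by obtain ⟨q, hq⟩ := T.dvd; omega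
  have da := Nat.div_add_mod a k
  have e : a + l = k * (a / k) + (a % k + l) := by omega
  have ediv : (a + l) / k = a / k := by
    rw [e, Nat.mul_add_div hk, Nat.div_eq_of_lt hlt', add_zero]
  have emod : (a + l) % k = a % k + l := by
    rw [e, Nat.mul_add_mod, Nat.mod_eq_of_lt hlt']
  rw [ediv, emod] at h3'
  rw [ediv] at h1'
  have hM : ¬ (a % k ≤ 4 * (i - fl (d (a / k))) + 1 ∧
      4 * (i - fl (d (a / k))) + 1 < a % k + l) := by
    rintro ⟨m1, m2⟩
    apply hc (4 * (i - fl (d (a / k))) + 1 - a % k) (by omega)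
    rw [← T.even_letter hi hik (a / k)]
    congr 2
    omega
  obtain ⟨q, hq⟩ := T.dvd
  constructor
  · omega
  · rw [h2, h2']
    split_ifs <;> omega

/-- Count and label of a factor around the fixed letter `4i - 1` alone. -/
theorem even_advance_fixed (T : IsBlockText k fl d c) {i : ℕ} (hi : 1 ≤ i) (hik : 4 * i < k)
    {a l : ℕ} (h1 : 4 * i - 2 ≤ a % k) (h2 : a % k + l ≤ 4 * i + 1) :
    evenCount fl d i (a + l) = evenCount fl d i a ∧
    (4 * i ≤ a % k + l → a % k < 4 * i → evenLabel fl d i (a + l) = evenLabel fl d i a + l ∧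
      ∀ j < l, (a + j) % 4 = 3 → evenLabel fl d i a + j + 1 ≡ 4 [MOD 8]) := by
  have hk : 0 < k := by omega
  have hlt : a % k < k := Nat.mod_lt _ hk
  have da := Nat.div_add_mod a k
  have k4 : k * (a / k) % 4 = 0 := Nat.mod_eq_zero_of_dvd (T.dvd.mul_right _)
  obtain ⟨q, hq⟩ := T.dvd
  have hlt' : a % k + l < k := by omega
  have e : a + l = k * (a / k) + (a % k + l) := by omega
  have ediv : (a + l) / k = a / k := by
    rw [e, Nat.mul_add_div hk, Nat.div_eq_of_lt hlt', add_zero]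
  have emod : (a + l) % k = a % k + l := by
    rw [e, Nat.mul_add_mod, Nat.mod_eq_of_lt hlt']
  have hf := T.flag_le (d (a / k))
  obtain ⟨o, m, g1, g2, g3, -⟩ := T.even_spec hi hik a
  obtain ⟨o', m', g1', g2', g3', -⟩ := T.even_spec hi hik (a + l)
  rw [ediv, emod] at g3'
  rw [ediv] at g1'
  clear e ediv emod
  have ho : o' = o := by clear g2 g2'; omega
  subst ho
  have hm : m' = m + l := by clear g2 g2'; omega
  refine ⟨by omega, fun h3 h4 => ⟨?_, fun j hj hj4 => ?_⟩⟩
  · rw [g2, g2']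
    clear g1 g1' g2 g2' g3'
    split_ifs <;> omega
  -- The position 4i - 1 has label 3 if the flag is 1 (marker already passed) and 2k + 3 if it is 0;
  -- adding 1 gives 4 modulo 8 both times. This is why values from k on are raised by k: k + 4 could
  -- be divisible by 8.
  · have hz : a % k + j = 4 * i - 1 := by clear g2 g2' g3 g3' g1 g1'; omega
    rw [g2, Nat.ModEq]
    clear g1 g1' g2 g2' g3'
    split_ifs <;> omega

/-- Two positions congruent modulo `k` whose blocks have equal flags have equal labels. -/
theorem even_congr (T : IsBlockText k fl d c) {i : ℕ} (hi : 1 ≤ i) (hik : 4 * i < k) {a a' : ℕ}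
    (h : a % k = a' % k)
    (hf : 4 * i - 2 ≤ a % k → a % k ≤ 4 * i + 1 → fl (d (a / k)) = fl (d (a' / k))) :
    evenLabel fl d i a = evenLabel fl d i a' ∧
      evenCount fl d i a + a' / k = evenCount fl d i a' + a / k := by
  obtain ⟨o, m, h1, h2, h3, -⟩ := T.even_spec hi hik a
  obtain ⟨o', m', h1', h2', h3', -⟩ := T.even_spec hi hik a'
  have fa := T.flag_le (d (a / k))
  have fa' := T.flag_le (d (a' / k))
  have ho : o = o' := by
    by_cases hr : 4 * i - 2 ≤ a % k ∧ a % k ≤ 4 * i + 1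
    · rw [hf hr.1 hr.2] at h3
      clear h2 h2'
      omega
    · clear h2 h2'
      omega
  subst ho
  have hm : m = m' := by clear h2 h2'; omega
  refine ⟨by rw [h2, h2', hm], by omega⟩

/-- Count and label determine the position. -/
theorem even_count_label (T : IsBlockText k fl d c) {i : ℕ} (hi : 1 ≤ i) (hik : 4 * i < k)
    (a : ℕ) : ∃ m, evenLabel fl d i a = (if k ≤ m then m + k else m) ∧
      k * evenCount fl d i a + m + 4 * i = a + k + 4 := by
  obtain ⟨o, m, h1, h2, h3, -⟩ := T.even_spec hi hik a
  have da := Nat.div_add_mod a k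
  refine ⟨m, h2, ?_⟩
  rw [h1, mul_add]
  rcases h3 with ⟨rfl, h, -⟩ | ⟨rfl, h, -⟩ <;> omega

/-- The letters `4i + 1` counted in a factor lie in the factor. -/
theorem even_mem (T : IsBlockText k fl d c) {i : ℕ} (hi : 1 ≤ i) (hik : 4 * i < k)
    {a b γ : ℕ} (ha : evenCount fl d i a ≤ γ) (hb : γ < evenCount fl d i b) :
    a ≤ k * γ + (4 * (i - fl (d γ)) + 1) ∧ k * γ + (4 * (i - fl (d γ)) + 1) < b := by
  have hk : 0 < k := by omega
  have hlt : a % k < k := Nat.mod_lt _ hk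
  have da := Nat.div_add_mod a k
  have db := Nat.div_add_mod b k
  obtain ⟨o, m, h1, -, h3, -⟩ := T.even_spec hi hik a
  obtain ⟨o', m', h1', -, h3', -⟩ := T.even_spec hi hik b
  constructor
  · rcases (by omega : γ = a / k ∧ o = 0 ∨ a / k + 1 ≤ γ) with ⟨hg, ho⟩ | hg
    · rw [hg]; omega
    · have := Nat.mul_le_mul_left k hg
      rw [Nat.mul_succ] at this
      omega
  · rcases (by omega : γ = b / k ∧ o' = 1 ∨ γ + 1 ≤ b / k) with ⟨hg, ho⟩ | hg
    · rw [hg]; omega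
    · have := Nat.mul_le_mul_left k hg
      rw [Nat.mul_succ] at this
      obtain ⟨q, hq⟩ := T.dvd
      omega

/-- Equal factors of the text that start at positions congruent modulo `k`, have equal labels
at their ends and contain a letter at a position congruent to `3` modulo `4`. -/
theorem gap_or_block_of_label_eq (T : IsBlockText k fl d c) {i : ℕ} (hi : 1 ≤ i)
    (hik : 4 * i < k) {a a' l : ℕ} (hm : ∀ j < l, c (a + j) = c (a' + j))
    {j3 : ℕ} (hj3 : j3 < l) (h3 : (a + j3) % 4 = 3) (hmod : a % k = a' % k)
    (hla : evenLabel fl d i a = evenLabel fl d i a')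
    (hlb : evenLabel fl d i (a + l) = evenLabel fl d i (a' + l))
    (hca : evenCount fl d i a + a' / k = evenCount fl d i a' + a / k)
    (hcb : evenCount fl d i (a + l) + (a' + l) / k = evenCount fl d i (a' + l) + (a + l) / k) :
    GapPair (evenCount fl d i) (evenLabel fl d i) a (a + l) a' (a' + l) ∨
    BlockPair d (evenCount fl d i) (evenLabel fl d i) a (a + l) a' (a' + l) := by
  have hk : 0 < k := by omega
  have hmodb : (a + l) % k = (a' + l) % k := Nat.ModEq.add_right l hmod
  have da := Nat.div_add_mod a k
  have da' := Nat.div_add_mod a' k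
  have ediv : (a + l) / k + a' / k = (a' + l) / k + a / k := by
    have db := Nat.div_add_mod (a + l) k
    have db' := Nat.div_add_mod (a' + l) k
    apply Nat.eq_of_mul_eq_mul_left hk
    rw [mul_add, mul_add]; omega
  have hk4 : ∀ β, k * β % 4 = 0 := fun β => Nat.mod_eq_zero_of_dvd (T.dvd.mul_right β)
  obtain ⟨m, hm1, hm2⟩ := T.even_count_label hi hik a
  obtain ⟨m', hm1', hm2'⟩ := T.even_count_label hi hik (a + l)
  rcases Nat.lt_trichotomy (evenCount fl d i a) (evenCount fl d i (a + l)) with hβ | hβ | hβ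
  · right
    refine ⟨hla, hlb, evenCount fl d i (a + l) - evenCount fl d i a, by omega, by omega,
      by omega, fun j hj => ?_⟩
    obtain ⟨le, lt⟩ := T.even_mem hi hik (a := a) (b := a + l)
      (γ := evenCount fl d i a + j) (by omega) (by omega)
    have hdiff : k * (evenCount fl d i a' + j) + a = k * (evenCount fl d i a + j) + a' := by
      have h := congrArg (k * ·) hca
      simp only [mul_add] at h ⊢
      omega
    generalize evenCount fl d i a + j = γ at *
    generalize evenCount fl d i a' + j = γ' at *
    have hf := T.flag_le (d γ)
    have kγ := hk4 γ
    clear hm1 hm1' hm2 hm2' hla hlb hca hcb ediv da da' hmodb hmod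
    have eq : ∀ r, a ≤ k * γ + r → k * γ + r < a + l → c (k * γ + r) = c (k * γ' + r) := by
      intro r h h'
      have e := hm (k * γ + r - a) (by omega)
      rwa [show a + (k * γ + r - a) = k * γ + r by omega,
        show a' + (k * γ + r - a) = k * γ' + r by omega] at e
    obtain ⟨q, hq⟩ := T.dvd
    -- The factor contains the marker and a position 3 mod 4, hence an even neighbour of the marker;
    -- marker and neighbour identify the block.
    by_cases hnext : k * γ + (4 * (i - fl (d γ)) + 2) < a + l
    · exact T.block_eq (r := 4 * (i - fl (d γ)) + 1) (s := 4 * (i - fl (d γ)) + 2) (by omega)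
        (by omega) (by omega) (by omega) (eq _ le lt) (eq _ (by omega) hnext)
    · exact T.block_eq (r := 4 * (i - fl (d γ)) + 1) (s := 4 * (i - fl (d γ))) (by omega)
        (by omega) (by omega) (by omega) (eq _ le lt) (eq _ (by omega) (by omega))
  · left
    have hb : m' = m + l := by rw [← hβ] at hm2'; omega
    have hpos : evenLabel fl d i a < evenLabel fl d i (a + l) := by
      rw [hm1, hm1']; split_ifs <;> omega
    exact ⟨hβ.symm, by omega, evenLabel fl d i (a + l) - evenLabel fl d i a, by omega, by omega,
      by omega, fun j _ => by rw [hla]⟩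
  · exfalso
    have h1 := Nat.mul_le_mul_left k (Nat.succ_le_of_lt hβ)
    rw [Nat.mul_succ] at h1
    obtain ⟨o, n, e1, -, e3, -⟩ := T.even_spec hi hik a
    obtain ⟨o', n', e1', -, e3', -⟩ := T.even_spec hi hik (a + l)
    have hle : a / k ≤ (a + l) / k := Nat.div_le_div_right (by omega)
    have heq : (a + l) / k = a / k := by omega
    have db := Nat.div_add_mod (a + l) k
    rw [heq] at e3' db
    omega

/-- The alternative required for desubstitution when every block is marked by its letter
`4i + 1`. -/
theorem gap_or_block_even (T : IsBlockText k fl d c) {i : ℕ} (hi : 1 ≤ i) (hik : 4 * i < k)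
    {a a' l : ℕ} (hl : 0 < l) (hm : ∀ j < l, c (a + j) = c (a' + j))
    (hsp : ∀ j < l, (c (a + j)).val = 4 * i + 1 → ∃ j < l, (a + j) % 4 = 3) :
    GapPair (evenCount fl d i) (evenLabel fl d i) a (a + l) a' (a' + l) ∨
    BlockPair d (evenCount fl d i) (evenLabel fl d i) a (a + l) a' (a' + l) := by
  have hk : 0 < k := by omega
  by_cases h3 : ∃ j < l, (a + j) % 4 = 3
  swap
  · left
    have hc : ∀ j < l, (c (a + j)).val ≠ 4 * i + 1 := fun j hj h => h3 (hsp j hj h)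
    have hc' : ∀ j < l, (c (a' + j)).val ≠ 4 * i + 1 := fun j hj => by
      rw [← hm j hj]; exact hc j hj
    push Not at h3
    have hlen : a % 4 + l ≤ 3 := by
      by_contra hc
      exact h3 (3 - a % 4) (by omega) (by omega)
    have hlen' : a' % 4 + l ≤ 3 := by
      by_contra hc
      have h : (a' + (3 - a' % 4)) % 4 = 3 := by omega
      exact h3 _ (by omega) (T.mod_four_congr (hm (3 - a' % 4) (by omega)).symm (by norm_num) h)
    obtain ⟨e1, e2⟩ := T.even_advance hi hik hlen hc
    obtain ⟨e1', e2'⟩ := T.even_advance hi hik hlen' hc'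
    exact ⟨e1, e1', l, hl, e2, e2', fun j hj => T.padicValNat_two_eq_of_ne_three (hm j hj)
      (h3 j hj) (T.evenLabel_mod_four hi hik a) (T.evenLabel_mod_four hi hik a')⟩
  obtain ⟨j3, hj3, h3⟩ := h3
  have hmod : a % k = a' % k := T.mod_eq_of_three hm hj3 h3
  have hmodb : (a + l) % k = (a' + l) % k := Nat.ModEq.add_right l hmod
  have hk4 : ∀ β, k * β % 4 = 0 := fun β => Nat.mod_eq_zero_of_dvd (T.dvd.mul_right β)
  have hlt : a % k < k := Nat.mod_lt _ hk
  have da := Nat.div_add_mod a k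
  have da' := Nat.div_add_mod a' k
  have db := Nat.div_add_mod (a + l) k
  have db' := Nat.div_add_mod (a' + l) k
  have ka := hk4 (a / k)
  have kb := hk4 ((a + l) / k)
  -- The marker sits at 4i + 1 or 4i - 3. A factor within positions 4i - 2, 4i - 1, 4i sees neither
  -- place, so the flags of the two blocks may differ; there the labels need only give equal ruler
  -- letters.
  by_cases hspec : 4 * i - 2 ≤ a % k ∧ a % k + l ≤ 4 * i + 1
  · left
    have h4 : a % k < 4 * i ∧ 4 * i ≤ a % k + l := by omega
    obtain ⟨e1, e2⟩ := T.even_advance_fixed hi hik hspec.1 hspec.2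
    obtain ⟨e2, e3⟩ := e2 h4.2 h4.1
    rw [hmod] at hspec h4
    obtain ⟨e1', e2'⟩ := T.even_advance_fixed hi hik hspec.1 hspec.2
    obtain ⟨e2', e3'⟩ := e2' h4.2 h4.1
    refine ⟨e1, e1', l, hl, e2, e2', fun j hj => ?_⟩
    by_cases hj4 : (a + j) % 4 = 3
    · have v := e3 j hj hj4
      have v' := e3' j hj (T.mod_four_congr (hm j hj) (by norm_num) hj4)
      apply padicValNat_two_congr (G := 3) (v.trans v'.symm)
      rw [v.dvd_iff (by norm_num)]
      norm_num
    · exact T.padicValNat_two_eq_of_ne_three (hm j hj) hj4 (T.evenLabel_mod_four hi hik a)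
        (T.evenLabel_mod_four hi hik a')
  have flag : ∀ (γ γ' r : ℕ), r < k → r % 4 = 1 → k * γ + r < a + l → a ≤ k * γ + r →
      k * γ + r + a' = k * γ' + r + a → fl (d γ) = fl (d γ') := by
    intro γ γ' r hr hr1 h1 h2 h3
    have e := hm (k * γ + r - a) (by omega)
    rw [show a + (k * γ + r - a) = k * γ + r by omega,
      show a' + (k * γ + r - a) = k * γ' + r by omega] at e
    have := T.flag_eq (by have := hk4 γ; omega)
      (by rw [Nat.mul_add_mod, Nat.mul_add_mod]) e
    rwa [Nat.mul_add_div hk, Nat.mul_add_div hk, Nat.div_eq_of_lt hr] at this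
  have hkmul : 4 * i + 4 ≤ k := by obtain ⟨q, hq⟩ := T.dvd; omega
  -- The flag matters only for an end between the two possible marker places. The factor then
  -- contains position 4i + 1 after its left end, or 4i - 3 before its right end, and the flag is
  -- read there.
  obtain ⟨la, ca⟩ := T.even_congr hi hik hmod (fun h h' =>
    flag (a / k) (a' / k) (4 * i + 1) (by omega) (by omega) (by omega) (by omega) (by omega))
  obtain ⟨lb, cb⟩ := T.even_congr hi hik hmodb (fun h h' =>
    flag ((a + l) / k) ((a' + l) / k) (4 * i - 3) (by omega) (by omega) (by omega)
      (by
        by_contra hc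
        apply hspec
        have : (a + l) / k = a / k := by
          apply le_antisymm
          · by_contra hcc
            have := Nat.mul_le_mul_left k (Nat.succ_le_of_lt (not_le.1 hcc))
            rw [Nat.mul_succ] at this
            omega
          · exact Nat.div_le_div_right (by omega)
        rw [this] at db hc
        omega) (by omega))
  exact T.gap_or_block_of_label_eq hi hik hm hj3 h3 hmod la lb ca cb

end IsBlockText

/-! ### The permutations and the iterated morphism -/

theorem formPerm_residue {k e r : ℕ} (hr : r < e) (he : e ∣ k) (P : Fin k → Bool)
    (hP : ∀ i, P i = true ↔ i.val % e = r) (x : Fin k) :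
    (((List.finRange k).filter P).formPerm x).val =
      if x.val % e = r then (x.val + e) % k else x.val := by
  obtain ⟨n, rfl⟩ := he
  have hlt : ∀ t : Fin n, e * t.val + r < e * n := fun t => by
    have := Nat.mul_le_mul_left e (Nat.succ_le_of_lt t.2)
    rw [Nat.mul_succ] at this
    omega
  have hl : (List.finRange (e * n)).filter P = List.ofFn fun t : Fin n => ⟨e * t.val + r, hlt t⟩ := by
    apply List.SortedLT.eq_of_mem_iff
    · exact ((List.sortedLT_finRange _).pairwise.filter _).sortedLT
    · rw [List.sortedLT_ofFn_iff]
      intro s t hst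
      have := Nat.mul_lt_mul_of_pos_left (Fin.lt_def.1 hst) (by omega : 0 < e)
      simp only [Fin.mk_lt_mk]
      omega
    · intro y
      simp only [List.mem_filter, List.mem_finRange, true_and, hP, List.mem_ofFn']
      constructor
      · intro hy
        have hd := Nat.div_add_mod y.val e
        refine ⟨⟨y.val / e, Nat.div_lt_of_lt_mul y.2⟩, ?_⟩
        ext
        simp only
        omega
      · rintro ⟨t, rfl⟩
        simp [Nat.mod_eq_of_lt hr]
  rw [hl]
  have hnd : (List.ofFn fun t : Fin n => (⟨e * t.val + r, hlt t⟩ : Fin (e * n))).Nodup := by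
    rw [← hl]; exact (List.nodup_finRange _).filter _
  split_ifs with hx
  · have hd := Nat.div_add_mod x.val e
    have ht : x.val / e < n := Nat.div_lt_of_lt_mul x.2
    have hxe : x = (List.ofFn fun t : Fin n => (⟨e * t.val + r, hlt t⟩ : Fin (e * n)))[x.val / e]'
        (by simpa using ht) := by
      ext
      simp only [List.getElem_ofFn]
      omega
    conv_lhs => rw [hxe]
    rw [List.formPerm_apply_getElem _ hnd]
    simp only [List.getElem_ofFn, List.length_ofFn]
    rcases (by omega : x.val / e + 1 < n ∨ x.val / e + 1 = n) with h | h
    · have := hlt ⟨_, h⟩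
      simp only [mul_add, mul_one] at this
      rw [Nat.mod_eq_of_lt h, Nat.mod_eq_of_lt (by omega), mul_add, mul_one]
      omega
    · have h1 : e * (x.val / e) + e = e * n := by
        have := congrArg (e * ·) h
        simpa only [mul_add, mul_one] using this
      rw [h, Nat.mod_self, mul_zero, zero_add, show x.val + e = e * n + r by omega,
        Nat.add_mod_left, Nat.mod_eq_of_lt]
      have := x.2
      omega
  · rw [List.formPerm_apply_of_notMem]
    rw [← hl, List.mem_filter, hP]
    exact fun h => hx h.2

/-- The flag of the `i`-th permutation: whether it moves the even numbers. -/
def permFlag {k : ℕ} (i : Fin k) : ℕ := if i.val < k / 2 then 0 else 1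

/-- The exponent of `f₁` in the `i`-th permutation. -/
def permShift {k : ℕ} (i : Fin k) : ℕ := if i.val < k / 2 then i.val + 1 else i.val - k / 2

section

variable {k : ℕ}

theorem cycleF_apply (hk : 4 ∣ k) (x : Fin k) :
    (cycleF k x).val = if x.val % 2 = 0 then (x.val + 2) % k else x.val :=
  formPerm_residue (by norm_num) (Dvd.dvd.trans (by norm_num) hk) _ (fun i => by simp; omega) x

theorem cycleG_apply (hk : 4 ∣ k) (x : Fin k) :
    (cycleG k x).val = if x.val % 4 = 1 then (x.val + 4) % k else x.val :=
  formPerm_residue (by norm_num) hk _ (fun i => by simp; omega) x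

theorem cycleF_pow_apply (hk : 4 ∣ k) (n : ℕ) (x : Fin k) :
    ((cycleF k ^ n) x).val = if x.val % 2 = 0 then (x.val + 2 * n) % k else x.val := by
  induction n with
  | zero => simp [Nat.mod_eq_of_lt x.2]
  | succ n ih =>
    rw [pow_succ', Equiv.Perm.mul_apply, cycleF_apply hk, ih]
    have h2 : ∀ y, y % k % 2 = y % 2 := fun y =>
      Nat.mod_mod_of_dvd _ (Dvd.dvd.trans (by norm_num) hk)
    split_ifs with h0 h1
    · rw [Nat.mod_add_mod]; congr 1
    · exact absurd (h2 (x.val + 2 * n)) (by omega)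
    · rfl

theorem permList_even (hk : 4 ∣ k) (i x : Fin k) (hx : x.val % 2 = 0) :
    (permList k i x).val = (x.val + 2 * permShift i) % k := by
  have h2 : ∀ y, y % k % 2 = y % 2 := fun y =>
    Nat.mod_mod_of_dvd _ (Dvd.dvd.trans (by norm_num) hk)
  unfold permList permShift
  split_ifs with h
  · rw [cycleF_pow_apply hk, if_pos hx]
  · have := h2 (x.val + 2 * (i.val - k / 2))
    rw [Equiv.Perm.mul_apply, cycleG_apply hk, cycleF_pow_apply hk, if_pos hx,
      if_neg (by omega)]

theorem permList_one (hk : 4 ∣ k) (i x : Fin k) (hx : x.val % 4 = 1) :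
    (permList k i x).val = (x.val + 4 * permFlag i) % k := by
  unfold permList permFlag
  split_ifs with h
  · rw [cycleF_pow_apply hk, if_neg (by omega), mul_zero, add_zero, Nat.mod_eq_of_lt x.2]
  · have hF : ((cycleF k ^ (i.val - k / 2)) x).val = x.val := by
      rw [cycleF_pow_apply hk, if_neg (by omega)]
    rw [Equiv.Perm.mul_apply, cycleG_apply hk, hF, if_pos hx]

theorem permList_three (hk : 4 ∣ k) (i x : Fin k) (hx : x.val % 4 = 3) :
    (permList k i x).val = x.val := by
  unfold permList
  split_ifs with h
  · rw [cycleF_pow_apply hk, if_neg (by omega)]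
  · have hF : ((cycleF k ^ (i.val - k / 2)) x).val = x.val := by
      rw [cycleF_pow_apply hk, if_neg (by omega)]
    rw [Equiv.Perm.mul_apply, cycleG_apply hk, hF, if_neg (by omega)]

/-- For a fixed flag the exponents of f₁ run once through the residues modulo k/2, the order of f₁.
-/
theorem eq_of_permShift_permFlag {i j x : Fin k} (hk : 4 ∣ k)
    (hs : (x.val + 2 * permShift i) % k = (x.val + 2 * permShift j) % k)
    (hf : permFlag i = permFlag j) : i = j := by
  obtain ⟨q, rfl⟩ := hk
  have h : 2 * permShift i ≡ 2 * permShift j [MOD 2 * (2 * q)] := by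
    rw [← mul_assoc]; exact Nat.ModEq.add_left_cancel' _ hs
  have h := Nat.ModEq.mul_left_cancel' (by norm_num) h
  have hi := i.2
  have hj := j.2
  unfold permFlag at hf
  unfold permShift at h
  ext
  split_ifs at hf h with h1 h2 h2
  · have := Nat.ModEq.add_right_cancel' 1 h
    rw [Nat.ModEq, Nat.mod_eq_of_lt (by omega), Nat.mod_eq_of_lt (by omega)] at this
    exact this
  · rw [Nat.ModEq, Nat.mod_eq_of_lt (by omega), Nat.mod_eq_of_lt (by omega)] at h
    omega

/-- The image of an infinite word under the uniform morphism given by `v`. -/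
def morphText (v : Fin k → Equiv.Perm (Fin k)) (d : ℕ → Fin k) (p : ℕ) : Fin k :=
  v (d (p / k)) ⟨p % k, Nat.mod_lt _ ((d 0).pos)⟩

theorem isBlockText_morphText (hk : 4 ∣ k) (hk8 : 8 ≤ k) (σ : Equiv.Perm (Fin k))
    (d : ℕ → Fin k) :
    IsBlockText k (fun x => permFlag (σ x)) d (morphText (fun i => permList k (σ i)) d) := by
  have h2 : ∀ y, y % k % 2 = y % 2 := fun y =>
    Nat.mod_mod_of_dvd _ (Dvd.dvd.trans (by norm_num) hk)
  have h4 : ∀ y, y % k % 4 = y % 4 := fun y => Nat.mod_mod_of_dvd _ hk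
  refine ⟨hk, hk8, fun x => ?_, fun p hp => ?_, fun p hp => ?_, fun p hp => ?_,
    fun p p' hp hpp hc hf => ?_⟩
  · unfold permFlag; split_ifs <;> omega
  · unfold morphText
    have := h2 p
    rw [permList_even hk _ _ (by simp only; omega), h2]
    simp only
    omega
  · unfold morphText
    rw [permList_one hk _ _ (by simp only; rw [h4, hp])]
  · unfold morphText
    rw [permList_three hk _ _ (by simp only; rw [h4, hp])]
  · unfold morphText at hc
    have := h2 p
    simp only [← hpp] at hc
    have e := congrArg Fin.val hc
    rw [permList_even hk _ _ (by simp only; omega), permList_even hk _ _ (by simp only; omega)] at e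
    exact σ.injective (eq_of_permShift_permFlag hk e hf)

theorem permMorphism_map_range (v : Fin k → Equiv.Perm (Fin k)) (d : ℕ → Fin k) (n : ℕ) :
    permMorphism v ((List.range n).map d) = (List.range (k * n)).map (morphText v d) := by
  have hk : 0 < k := (d 0).pos
  induction n with
  | zero => simp [permMorphism]
  | succ n ih =>
    unfold permMorphism at ih ⊢
    rw [List.range_succ, List.map_append, List.flatMap_append, ih, Nat.mul_succ, List.range_add,
      List.map_append]
    congr 1
    apply List.ext_getElem
    · simp
    · intro i h1 h2
      have hi : i < k := by simpa using h2
      simp [morphText, Nat.mul_add_div hk, Nat.div_eq_of_lt hi, Nat.mod_eq_of_lt hi]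

/-- The iterated images of a constant infinite word. -/
def iterText (hk : 0 < k) (v : Fin k → Equiv.Perm (Fin k)) : ℕ → ℕ → Fin k
  | 0 => fun _ => ⟨0, hk⟩
  | m + 1 => morphText v (iterText hk v m)

theorem iterWord_eq (hk : 0 < k) (v : Fin k → Equiv.Perm (Fin k)) (m : ℕ) :
    iterWord hk v m = (List.range (k ^ m)).map (iterText hk v m) := by
  induction m with
  | zero => simp [iterWord, iterText]
  | succ m ih =>
    unfold iterWord at ih ⊢
    rw [Function.iterate_succ_apply', ih, permMorphism_map_range, pow_succ']
    rfl

end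

/-! ### Choosing the marker -/

/-- The odd number `v` occurs in the piece of the text that a parse assigns to the letter `x`. -/
def OddChar {V : Type*} {k : ℕ} (u : List V) (c : ℕ → Fin k) (B : ℕ → ℕ) (x : V) (v : ℕ) : Prop :=
  v % 2 = 1 ∧ ∃ j p, u[j]? = some x ∧ B j ≤ p ∧ p < B (j + 1) ∧ (c p).val = v

/-- The odd number `v` is the only odd number in the piece of the text assigned to `x`. -/
def OnlyOddChar {V : Type*} {k : ℕ} (u : List V) (c : ℕ → Fin k) (B : ℕ → ℕ) (x : V) (v : ℕ) :
    Prop :=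
  OddChar u c B x v ∧ ∀ v', OddChar u c B x v' → v' = v

/-- A parse of `u` in a text can be replaced by one in the word `d` of its blocks, with pieces
inside the first `N` letters of `d`, in such a way that parses in the ruler sequence lift back. -/
def Desubstitutes {V A : Type*} (u : List V) (d : ℕ → A) (B : ℕ → ℕ) (N : ℕ) : Prop :=
  ∃ B', IsParse u d B' ∧ (∀ j < u.length, B' j < B' (j + 1) → B' (j + 1) ≤ N) ∧
    ∀ R', IsParse u (fun p => padicValNat 2 (p + 1)) R' →
      (∀ j < u.length, (R' j < R' (j + 1) ↔ B' j < B' (j + 1))) →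
      ∃ R, IsParse u (fun p => padicValNat 2 (p + 1)) R ∧
        ∀ j < u.length, (R j < R (j + 1) ↔ B j < B (j + 1))

section

variable {V : Type*} {u : List V} {k : ℕ} {fl : Fin k → ℕ} {d c : ℕ → Fin k} {B : ℕ → ℕ} {N : ℕ}

theorem OddChar.exists_mem (hB : IsParse u c B) {x : V} {v j : ℕ} (h : OddChar u c B x v)
    (hj : u[j]? = some x) : ∃ p, B j ≤ p ∧ p < B (j + 1) ∧ (c p).val = v := by
  obtain ⟨-, j', p, hj', h1, h2, h3⟩ := h
  obtain ⟨l, e1, e2, e3⟩ := hB j' j x hj' hj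
  refine ⟨B j + (p - B j'), by omega, by omega, ?_⟩
  rw [← e3 _ (by omega), Nat.add_sub_cancel' h1, h3]

/-- If `v` is not the only odd number of a piece, a piece containing it contains one of its two
odd neighbours. -/
theorem IsBlockText.exists_neighbour (T : IsBlockText k fl d c) (hB : IsParse u c B) {x : V}
    {v j p : ℕ} (hv : v % 2 = 1) (hno : ¬ OnlyOddChar u c B x v) (hj : u[j]? = some x)
    (h1 : B j ≤ p) (h2 : p < B (j + 1)) (h3 : (c p).val = v) :
    B j + 2 ≤ p ∨ p + 2 < B (j + 1) := by
  have hx : OddChar u c B x v := ⟨hv, j, p, hj, h1, h2, h3⟩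
  simp only [OnlyOddChar, hx, true_and, not_forall] at hno
  obtain ⟨v', hv', hne⟩ := hno
  obtain ⟨p', h1', h2', h3'⟩ := hv'.exists_mem hB hj
  have m := T.mod_two p
  have m' := T.mod_two p'
  have := hv'.1
  have : p ≠ p' := by rintro rfl; exact hne (h3'.symm.trans h3)
  omega

theorem desubstitutes_of {β lam : ℕ → ℕ} {G : ℕ} (hB : IsParse u c B)
    (hlam : ∀ p, lam p < 2 ^ G)
    (H : ∀ (j j' : ℕ) (x : V) (l : ℕ), u[j]? = some x → u[j']? = some x → 0 < l →
      B (j + 1) = B j + l → B (j' + 1) = B j' + l → (∀ i < l, c (B j + i) = c (B j' + i)) →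
      GapPair β lam (B j) (B j + l) (B j') (B j' + l) ∨
      BlockPair d β lam (B j) (B j + l) (B j') (B j' + l))
    (hN : ∀ j < u.length, B j < B (j + 1) → β (B j) < β (B (j + 1)) → β (B (j + 1)) ≤ N) :
    Desubstitutes u d B N := by
  obtain ⟨h1, h2⟩ := hB.desubstitute (d := d) hlam (by
    intro j j' x hj hj' hlt
    obtain ⟨l, e1, e2, e3⟩ := hB j j' x hj hj'
    rw [e1, e2]
    exact H j j' x l hj hj' (by omega) e1 e2 e3)
  refine ⟨_, h1, fun j hj hlt => hN j hj ?_ hlt, h2⟩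
  rcases (hB.mono (Nat.le_succ j) hj).lt_or_eq with h | h
  · exact h
  · simp only [← h, lt_irrefl] at hlt

/-- Equal factors starting at positions congruent modulo `k` agree block by block. -/
theorem eq_of_block_shift {A : Type*} {c : ℕ → A} {s a a' l i x : ℕ}
    (hmod : a ≡ a' [MOD k]) (hm : ∀ i < l, c (a + i) = c (a' + i))
    (h1 : a ≤ k * ((a + s) / k + i) + x) (h2 : k * ((a + s) / k + i) + x < a + l) :
    c (k * ((a + s) / k + i) + x) = c (k * ((a' + s) / k + i) + x) := by
  have d1 := Nat.div_add_mod (a + s) k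
  have d2 := Nat.div_add_mod (a' + s) k
  have e : (a + s) % k = (a' + s) % k := hmod.add_right s
  have := hm (k * ((a + s) / k + i) + x - a) (by omega)
  rw [mul_add] at *
  rw [mul_add]
  rw [show a + (k * ((a + s) / k) + k * i + x - a) = k * ((a + s) / k) + k * i + x by omega,
    show a' + (k * ((a + s) / k) + k * i + x - a) = k * ((a' + s) / k) + k * i + x by omega] at this
  exact this

/-- Bounds for the marker of a block counted in a factor. -/
theorem marker_mem (hk : 0 < k) {s a b γ : ℕ} (h1 : (a + s) / k ≤ γ) (h2 : γ < (b + s) / k) :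
    a + s < k * γ + k ∧ k * γ + k ≤ b + s := by
  have d1 := Nat.div_add_mod (a + s) k
  have d2 := Nat.div_add_mod (b + s) k
  have m1 := Nat.mod_lt (a + s) hk
  have e1 := Nat.mul_le_mul_left k h1
  have e2 := Nat.mul_le_mul_left k (Nat.succ_le_of_lt h2)
  rw [Nat.mul_succ] at e2
  omega

/-- A piece containing position 4t + 3 of a block extends at least two further to one side, so it
contains positions 4t + 1, 4t + 2 or 4t + 4, 4t + 5 of that block. Either pair identifies the block.
-/
theorem desubstitutes_three (T : IsBlockText k fl d c) (hB : IsParse u c B)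
    (hN : ∀ j < u.length, B j < B (j + 1) → B (j + 1) ≤ k * N) {t : ℕ} (ht : 4 * t + 4 < k)
    (hno : ∀ x, ¬ OnlyOddChar u c B x (4 * t + 3)) : Desubstitutes u d B N := by
  have hk : 0 < k := by omega
  have hk4 : ∀ β, k * β % 4 = 0 := fun β => Nat.mod_eq_zero_of_dvd (T.dvd.mul_right β)
  -- With this shift, (p + s) / k counts the markers at positions before p.
  obtain ⟨s, hs⟩ : ∃ s, s + (4 * t + 4) = k := ⟨k - (4 * t + 4), by omega⟩
  have hs4 : 4 ∣ s := (Nat.dvd_add_left (by omega : 4 ∣ 4 * t + 4)).1 (hs ▸ T.dvd)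
  refine desubstitutes_of (β := fun p => (p + s) / k) (lam := fun p => (p + s) % k) (G := k) hB
    (fun p => (Nat.mod_lt _ hk).trans Nat.lt_two_pow_self) ?_ ?_
  · intro j j' x l hj hj' hl e1 e2 hm
    refine T.gap_or_block hs4 hl hm fun hmod i hi => ?_
    obtain ⟨b1, b2⟩ := marker_mem hk (Nat.le_add_right _ i) hi
    have kγ := hk4 ((B j + s) / k + i)
    have key := fun x => eq_of_block_shift (s := s) (i := i) (x := x) hmod hm
    obtain ⟨q, hq⟩ := T.dvd
    have hmark : (c (k * ((B j + s) / k + i) + (4 * t + 3))).val = 4 * t + 3 := by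
      rw [T.three _ (by omega), Nat.mul_add_mod, Nat.mod_eq_of_lt (by omega)]
    rcases T.exists_neighbour hB (by omega) (hno x) hj (by omega) (by omega) hmark with h | h
    · exact T.block_eq (r := 4 * t + 1) (s := 4 * t + 2) (by omega) (by omega) (by omega) (by omega)
        (key _ (by omega) (by omega)) (key _ (by omega) (by omega))
    · exact T.block_eq (r := 4 * t + 5) (s := 4 * t + 4) (by omega) (by omega) (by omega) (by omega)
        (key _ (by omega) (by omega)) (key _ (by omega) (by omega))
  · intro j hj hlt _
    have := hN j hj hlt
    rw [← Nat.lt_succ_iff, Nat.div_lt_iff_lt_mul hk, Nat.succ_mul, mul_comm N k]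
    omega

/-- A piece containing 4i + 1 extends at least two further to one side, and there it meets a
position 3 mod 4. -/
theorem desubstitutes_one (T : IsBlockText k fl d c) (hB : IsParse u c B)
    (hN : ∀ j < u.length, B j < B (j + 1) → B (j + 1) ≤ k * N) {i : ℕ} (hi : 1 ≤ i)
    (hik : 4 * i < k) (hno : ∀ x, ¬ OnlyOddChar u c B x (4 * i + 1)) : Desubstitutes u d B N := by
  have hk : 0 < k := by omega
  refine desubstitutes_of (β := evenCount fl d i) (lam := evenLabel fl d i) (G := 2 * k + 6) hB
    (fun p => (T.evenLabel_lt hi hik p).trans Nat.lt_two_pow_self) ?_ ?_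
  · intro j j' x l hj hj' hl e1 e2 hm
    refine T.gap_or_block_even hi hik hl hm fun i' hi' hc => ?_
    have h1 := (T.mod_four_iff (B j + i') (r := 1) (by norm_num)).1 (by omega)
    rcases T.exists_neighbour hB (by omega) (hno x) hj (Nat.le_add_right _ i') (by omega) hc
      with h | h
    · exact ⟨i' - 2, by omega, by omega⟩
    · exact ⟨i' + 2, by omega, by omega⟩
  · intro j hj hlt _
    have h := hN j hj hlt
    obtain ⟨o, m, h1, -, h3, -⟩ := T.even_spec hi hik (B (j + 1))
    have d1 := Nat.div_add_mod (B (j + 1)) k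
    rw [h1]
    by_contra hc
    have := Nat.mul_le_mul_left k (by omega : N + 1 ≤ B (j + 1) / k + o)
    rw [mul_add, mul_add, mul_one] at this
    rcases h3 with ⟨rfl, -⟩ | ⟨rfl, -, h4⟩ <;> omega

theorem exists_piece {B : ℕ → ℕ} {j j' p : ℕ} (hjj : j ≤ j') (h1 : B j ≤ p) (h2 : p < B j') :
    ∃ i, j ≤ i ∧ i < j' ∧ B i ≤ p ∧ p < B (i + 1) := by
  induction j', hjj using Nat.le_induction with
  | base => omega
  | succ n hn ih =>
    by_cases h : p < B n
    · obtain ⟨i, a1, a2, a3, a4⟩ := ih h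
      exact ⟨i, a1, by omega, a3, a4⟩
    · exact ⟨n, hn, by omega, by omega, h2⟩

/-- The letter 1 stands at position 1 or, moved by g₁, at position k - 3; in both cases it avoids
position 0 and the last two positions of the block. -/
theorem IsBlockText.exists_letter_one (T : IsBlockText k fl d c) (γ : ℕ) :
    ∃ r, 1 ≤ r ∧ r + 2 < k ∧ (c (k * γ + r)).val = 1 := by
  have hk := T.le
  have hk4 : k * γ % 4 = 0 := Nat.mod_eq_zero_of_dvd (T.dvd.mul_right γ)
  have hf := T.flag_le (d γ)
  obtain ⟨q, hq⟩ := T.dvd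
  have e : ∀ r, r % 4 = 1 → r < k → (c (k * γ + r)).val = (r + 4 * fl (d γ)) % k := by
    intro r hr hrk
    rw [T.one _ (by omega), Nat.mul_add_div (by omega), Nat.div_eq_of_lt hrk, Nat.mul_add_mod,
      Nat.mod_eq_of_lt hrk, add_zero]
  rcases (by omega : fl (d γ) = 0 ∨ fl (d γ) = 1) with h | h
  · refine ⟨1, le_rfl, by omega, ?_⟩
    rw [e 1 (by omega) (by omega), h, mul_zero, add_zero, Nat.mod_eq_of_lt (by omega)]
  · refine ⟨k - 3, by omega, by omega, ?_⟩
    rw [e _ (by omega) (by omega), h, show k - 3 + 4 * 1 = k + 1 by omega, Nat.add_mod_left,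
      Nat.mod_eq_of_lt (by omega)]

/-- The remaining case: a single letter takes care of all last positions of blocks, and of all
occurrences of the letter `1` of the text. -/
theorem desubstitutes_last (T : IsBlockText k fl d c) (hB : IsParse u c B)
    (hN : ∀ j < u.length, B j < B (j + 1) → B (j + 1) ≤ k * N)
    (hY : ∀ x x' v v', OddChar u c B x v → OddChar u c B x' v' → (v = 1 ∨ v = k - 1) →
      (v' = 1 ∨ v' = k - 1) → x = x') : Desubstitutes u d B N := by
  have hk8 := T.le
  have hk : 0 < k := by omega
  have hk4 : ∀ β, k * β % 4 = 0 := fun β => Nat.mod_eq_zero_of_dvd (T.dvd.mul_right β)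
  obtain ⟨q, hq⟩ := T.dvd
  have hmark : ∀ γ, (c (k * γ + (k - 1))).val = k - 1 := fun γ => by
    have := hk4 γ
    rw [T.three _ (by omega), Nat.mul_add_mod, Nat.mod_eq_of_lt (by omega)]
  have hlam : ∀ p, (p + 0) % k < 2 ^ k := fun p => (Nat.mod_lt _ hk).trans Nat.lt_two_pow_self
  -- If every piece containing a marker starts early enough, it contains positions k - 3 and k - 2
  -- of each marked block, which identify it.
  by_cases D1 : ∀ j < u.length, ∀ γ, B j ≤ k * γ + (k - 1) → k * γ + (k - 1) < B (j + 1) →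
      B j % k + 3 ≤ k
  · refine desubstitutes_of (β := fun p => (p + 0) / k) (lam := fun p => (p + 0) % k) (G := k) hB
      hlam ?_ ?_
    · intro j j' x l hj hj' hl e1 e2 hm
      refine T.gap_or_block (dvd_zero 4) hl hm fun hmod i hi => ?_
      obtain ⟨b1, b2⟩ := marker_mem hk (Nat.le_add_right _ i) hi
      have key := fun x => eq_of_block_shift (s := 0) (i := i) (x := x) hmod hm
      have h3 := D1 j (List.getElem?_eq_some_iff.1 hj).1 ((B j + 0) / k + i) (by omega) (by omega)
      have d1 := Nat.div_add_mod (B j) k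
      have hle : B j ≤ k * ((B j + 0) / k + i) + (k - 3) := by
        rw [mul_add, add_zero]; omega
      exact T.block_eq (r := k - 3) (s := k - 2) (by omega) (by omega) (by omega) (by omega)
        (key _ (by omega) (by omega)) (key _ (by omega) (by omega))
    · intro j hj hlt _
      have := hN j hj hlt
      rw [← Nat.lt_succ_iff, Nat.div_lt_iff_lt_mul hk, Nat.succ_mul, mul_comm N k]
      omega
  -- If every piece containing a marker ends late enough, it contains positions 0 and 1 of the block
  -- after each marker. A marker then stands for the following block, whence the shift of `d` by one
  -- and the bound `N - 1`.
  by_cases D2 : ∀ j < u.length, ∀ γ, B j ≤ k * γ + (k - 1) → k * γ + (k - 1) < B (j + 1) →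
      2 ≤ B (j + 1) % k
  · obtain ⟨B', h1, h2, h3⟩ : Desubstitutes u (fun n => d (n + 1)) B (N - 1) := by
      refine desubstitutes_of (β := fun p => (p + 0) / k) (lam := fun p => (p + 0) % k) (G := k)
        hB hlam ?_ ?_
      · intro j j' x l hj hj' hl e1 e2 hm
        refine T.gap_or_block (dvd_zero 4) hl hm fun hmod i hi => ?_
        obtain ⟨b1, b2⟩ := marker_mem hk (Nat.le_add_right _ i) hi
        have key := fun x => eq_of_block_shift (s := 0) (i := i) (x := x) hmod hm
        have h3 := D2 j (List.getElem?_eq_some_iff.1 hj).1 ((B j + 0) / k + i) (by omega) (by omega)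
        have d1 := Nat.div_add_mod (B (j + 1)) k
        have hlt : k * ((B j + 0) / k + i) + (k + 1) < B j + l := by
          have h4 : (B j + 0) / k + i + 1 ≤ (B j + l + 0) / k := hi
          have h5 := Nat.mul_le_mul_left k h4
          rw [mul_add k _ 1, mul_one] at h5
          rw [e1] at d1 h3
          simp only [add_zero] at h3 h5 b1 ⊢
          omega
        have k0 := key k (by omega) (by omega)
        have k1 := key (k + 1) (by omega) (by omega)
        refine T.block_eq (r := 1) (s := 0) (by omega) (by omega) (by omega) (by omega) ?_ ?_
        · simpa only [mul_add, mul_one, add_assoc] using k1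
        · simpa only [mul_add, mul_one, add_assoc, add_zero] using k0
      · intro j hj hlt h4
        have h5 := hN j hj hlt
        obtain ⟨b1, b2⟩ := marker_mem hk (a := B j) (b := B (j + 1)) (s := 0) le_rfl h4
        have h6 := D2 j hj ((B j + 0) / k) (by omega) (by omega)
        have h7 : B (j + 1) ≠ k * N := by
          intro h; rw [h, Nat.mul_mod_right] at h6; omega
        have h8 : (B (j + 1) + 0) / k < N := by
          rw [Nat.div_lt_iff_lt_mul hk, mul_comm N k]; omega
        exact Nat.le_sub_one_of_lt h8
    refine ⟨fun j => B' j + 1, ?_, ?_, ?_⟩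
    · intro j j' x hj hj'
      obtain ⟨l, e1, e2, e3⟩ := h1 j j' x hj hj'
      refine ⟨l, by dsimp only; omega, by dsimp only; omega, fun i hi => ?_⟩
      have := e3 i hi
      dsimp only at this ⊢
      rwa [add_right_comm _ 1 i, add_right_comm _ 1 i]
    · intro j hj hlt
      dsimp only at hlt
      have := h2 j hj (by omega)
      dsimp only
      omega
    · simpa only [Nat.add_lt_add_iff_right] using h3
  -- Both failures concern the one pattern letter whose pieces contain k - 1. So each of its pieces
  -- starts in the last two positions of a block and ends at residue 0 or 1.
  push Not at D1 D2
  obtain ⟨j1, hj1, γ1, p1, q1, r1⟩ := D1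
  obtain ⟨j2, hj2, γ2, p2, q2, r2⟩ := D2
  have chark : ∀ (j γ : ℕ) (x : V), u[j]? = some x → B j ≤ k * γ + (k - 1) →
      k * γ + (k - 1) < B (j + 1) → OddChar u c B x (k - 1) := fun j γ x hj h1 h2 =>
    ⟨by omega, j, _, hj, h1, h2, hmark γ⟩
  have x1 : u[j1]? = some u[j1] := List.getElem?_eq_getElem hj1
  have x2 : u[j2]? = some u[j2] := List.getElem?_eq_getElem hj2
  have c1 := chark j1 γ1 _ x1 p1 q1
  have c2 := chark j2 γ2 _ x2 p2 q2
  have e12 := hY _ _ _ _ c1 c2 (Or.inr rfl) (Or.inr rfl)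
  have start : ∀ (j : ℕ), u[j]? = some u[j1] → k ≤ B j % k + 2 ∧ B (j + 1) % k ≤ 1 := by
    intro j hj
    constructor
    · obtain ⟨l, e1, e2, e3⟩ := hB j1 j _ x1 hj
      have := hk4 γ1
      have h := T.mod_eq_of_three e3 (i := k * γ1 + (k - 1) - B j1) (by omega) (by omega)
      rw [← h]; omega
    · rw [e12] at hj
      obtain ⟨l, e1, e2, e3⟩ := hB j2 j _ x2 hj
      have := hk4 γ2
      have h := T.mod_eq_of_three e3 (i := k * γ2 + (k - 1) - B j2) (by omega) (by omega)
      have h' : (B j2 + l) % k = (B j + l) % k := h.add_right l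
      rw [e2, ← h', ← e1]; omega
  have far : ∀ a γ, k * γ ≤ a → k ≤ a % k + 2 → k * γ + k ≤ a + 2 := by
    intro a γ h1 h2
    have d1 := Nat.div_add_mod a k
    have h3 : γ ≤ a / k := (Nat.le_div_iff_mul_le hk).2 (by rw [mul_comm]; exact h1)
    have := Nat.mul_le_mul_left k h3
    omega
  -- That letter occurs once in u. Between two of its pieces there would be a letter 1, which only
  -- another of its pieces may contain; but such a piece would start after this letter 1. With a
  -- single occurrence, the agreement of block letters is trivial.
  have uniq : ∀ j j' : ℕ, u[j]? = some u[j1] → u[j']? = some u[j1] → ¬ j < j' := by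
    intro j j' hj hj' hlt
    have hlen' := (List.getElem?_eq_some_iff.1 hj').1
    have s1 := (start j hj).2
    have s2 := (start j' hj').1
    have m1 := hB.mono (Nat.succ_le_of_lt hlt) hlen'.le
    simp only [Nat.succ_eq_add_one] at m1
    have d1 := Nat.div_add_mod (B (j + 1)) k
    obtain ⟨r, hr1, hr2, hr3⟩ := T.exists_letter_one (B (j + 1) / k)
    have f1 := far (B j') (B (j + 1) / k) (by omega) s2
    obtain ⟨j'', a1, a2, a3, a4⟩ := exists_piece (B := B)
      (p := k * (B (j + 1) / k) + r) (Nat.succ_le_of_lt hlt) (by simp only [Nat.succ_eq_add_one]; omega)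
      (by omega)
    have hj'' : u[j'']? = some (u[j'']'(by omega)) := List.getElem?_eq_getElem _
    have e := hY _ _ _ _ c1 ⟨by norm_num, j'', _, hj'', a3, a4, hr3⟩ (Or.inr rfl) (Or.inl rfl)
    rw [← e] at hj''
    have m2 := hB.mono a1 (by omega)
    simp only [Nat.succ_eq_add_one] at m2
    have f2 := far (B j'') (B (j + 1) / k) (by omega) (start j'' hj'').1
    omega
  refine desubstitutes_of (β := fun p => (p + 0) / k) (lam := fun p => (p + 0) % k) (G := k) hB
    hlam ?_ ?_
  · intro j j' x l hj hj' hl e1 e2 hm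
    refine T.gap_or_block (dvd_zero 4) hl hm fun hmod i hi => ?_
    obtain ⟨b1, b2⟩ := marker_mem hk (Nat.le_add_right _ i) hi
    have e := hY _ _ _ _ c1 (chark j ((B j + 0) / k + i) x hj (by omega) (by omega))
      (Or.inr rfl) (Or.inr rfl)
    rw [← e] at hj hj'
    have hjj : j = j' := le_antisymm (not_lt.1 (uniq j' j hj' hj)) (not_lt.1 (uniq j j' hj hj'))
    rw [hjj]
  · intro j hj hlt _
    have := hN j hj hlt
    rw [← Nat.lt_succ_iff, Nat.div_lt_iff_lt_mul hk, Nat.succ_mul, mul_comm N k]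
    omega

theorem desubstitutes (T : IsBlockText k fl d c) (hB : IsParse u c B)
    (hN : ∀ j < u.length, B j < B (j + 1) → B (j + 1) ≤ k * N)
    (hα : 2 * numLetters u + 2 ≤ k) : Desubstitutes u d B N := by
  by_cases h : ∃ v, v % 2 = 1 ∧ 3 ≤ v ∧ v + 3 ≤ k ∧ ∀ x, ¬ OnlyOddChar u c B x v
  · obtain ⟨v, h1, h2, h3, h4⟩ := h
    obtain ⟨q, hq⟩ := T.dvd
    rcases (by omega : v % 4 = 1 ∨ v % 4 = 3) with hv | hv
    · obtain ⟨i, rfl⟩ : ∃ i, v = 4 * i + 1 := ⟨v / 4, by omega⟩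
      exact desubstitutes_one T hB hN (by omega) (by omega) h4
    · obtain ⟨t, rfl⟩ : ∃ t, v = 4 * t + 3 := ⟨v / 4, by omega⟩
      exact desubstitutes_three T hB hN (by omega) h4
  · push Not at h
    have hk8 := T.le
    refine desubstitutes_last T hB hN fun x x' v v' hv hv' h1 h1' => ?_
    by_contra hne
    -- The k/2 - 2 numbers are 3, 5, …, k - 3. Their letters are distinct and differ from `x` and
    -- `x'`, which makes k/2 letters of u, one too many.
    have h' : ∀ n : Fin (k / 2 - 2), ∃ y, OnlyOddChar u c B y (2 * n.val + 3) := fun n =>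
      h _ (by omega) (by omega) (by have := n.2; omega)
    choose f hf using h'
    have out : ∀ y v, OddChar u c B y v → (v = 1 ∨ v = k - 1) → ∀ n, f n ≠ y := by
      rintro y v hy hv n rfl
      have := (hf n).2 v hy
      have := n.2
      omega
    let g : Fin (k / 2 - 2) ⊕ Bool → V := Sum.elim f fun b => if b then x else x'
    have hg : Function.Injective g := by
      rintro (n | b) (n' | b') e
      · simp only [g, Sum.elim_inl] at e
        have h1 := (hf n).1
        rw [e] at h1
        have := (hf n').2 _ h1
        congr 1
        ext
        omega
      · simp only [g, Sum.elim_inl, Sum.elim_inr] at e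
        split_ifs at e
        · exact absurd e (out x v hv h1 n)
        · exact absurd e (out x' v' hv' h1' n)
      · simp only [g, Sum.elim_inl, Sum.elim_inr] at e
        split_ifs at e
        · exact absurd e.symm (out x v hv h1 n')
        · exact absurd e.symm (out x' v' hv' h1' n')
      · cases b <;> cases b' <;> simp_all [g, eq_comm]
    have mem : ∀ y v, OddChar u c B y v → y ∈ u := by
      rintro y v ⟨-, j, p, hj, -⟩
      exact List.mem_of_getElem? hj
    have hsub : Set.range g ⊆ {y | y ∈ u} := by
      rintro y ⟨n | b, rfl⟩
      · exact mem _ _ (hf n).1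
      · cases b
        · exact mem _ _ hv'
        · exact mem _ _ hv
    have hfin : {y | y ∈ u}.Finite := List.finite_toSet u
    have hcard := Set.ncard_le_ncard hsub hfin
    rw [← Set.image_univ, Set.ncard_image_of_injective _ hg, Set.ncard_univ,
      Nat.card_eq_fintype_card, Fintype.card_sum, Fintype.card_fin, Fintype.card_bool] at hcard
    obtain ⟨q, hq⟩ := T.dvd
    unfold numLetters at hα
    omega

end

/-! ### Induction on the number of iterations -/

/-- A parse in the iterated text gives a parse in the ruler sequence. -/
theorem exists_ruler_parse {V : Type*} {u : List V} {k : ℕ} (hk : 0 < k) (hk4 : 4 ∣ k)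
    (hk8 : 8 ≤ k) (hα : 2 * numLetters u + 2 ≤ k) (σ : Equiv.Perm (Fin k)) (m : ℕ) :
    ∀ B : ℕ → ℕ, IsParse u (iterText hk (fun i => permList k (σ i)) m) B →
      (∀ j < u.length, B j < B (j + 1) → B (j + 1) ≤ k ^ m) →
      ∃ R, IsParse u (fun p => padicValNat 2 (p + 1)) R ∧
        ∀ j < u.length, (R j < R (j + 1) ↔ B j < B (j + 1)) := by
  induction m with
  | zero =>
    intro B hB hN
    -- In a one-letter word every nonempty piece is the interval [0, 1), so the parse itself is
    -- valid in the ruler sequence.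
    refine ⟨B, fun j j' x hj hj' => ?_, fun _ _ => Iff.rfl⟩
    obtain ⟨l, e1, e2, -⟩ := hB j j' x hj hj'
    refine ⟨l, e1, e2, fun i hi => ?_⟩
    have h1 := hN j (List.getElem?_eq_some_iff.1 hj).1 (by omega)
    have h2 := hN j' (List.getElem?_eq_some_iff.1 hj').1 (by omega)
    rw [pow_zero] at h1 h2
    rw [show B j = 0 by omega, show B j' = 0 by omega]
  | succ m ih =>
    intro B hB hN
    obtain ⟨B', h1, h2, h3⟩ := desubstitutes (isBlockText_morphText hk4 hk8 σ _) hB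
      (by simpa only [pow_succ'] using hN) hα
    obtain ⟨R', hR', hs⟩ := ih B' h1 h2
    exact h3 R' hR' hs

/-- A value of `u` in a factor of an infinite word gives a parse. -/
theorem exists_parse_of_containsValue {V A : Type*} {u : List V} {c : ℕ → A} {n : ℕ}
    (h : ContainsValue u ((List.range n).map c)) :
    ∃ B, IsParse u c B ∧ ∀ j < u.length, B j < B (j + 1) ∧ B (j + 1) ≤ n := by
  obtain ⟨φ, hφ, p, s, hps⟩ := h
  have hstep : ∀ (j : ℕ) (x : V), u[j]? = some x →
      ((u.take (j + 1)).flatMap φ) = (u.take j).flatMap φ ++ φ x := by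
    intro j x hj
    rw [List.take_add_one, hj]
    simp
  have hrest : ∀ j, u.flatMap φ = (u.take j).flatMap φ ++ (u.drop j).flatMap φ := fun j => by
    rw [← List.flatMap_append, List.take_append_drop]
  have hlen := congrArg List.length hps
  simp only [List.length_append, List.length_map, List.length_range] at hlen
  have hle : ∀ j, p.length + ((u.take j).flatMap φ).length ≤ n := fun j => by
    have := congrArg List.length (hrest j)
    rw [List.length_append] at this
    omega
  have hchar : ∀ (j : ℕ) (x : V), u[j]? = some x → ∀ i (hi : i < (φ x).length),
      c (p.length + ((u.take j).flatMap φ).length + i) = (φ x)[i] := by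
    intro j x hj i hi
    have e : (List.range n).map c = (p ++ (u.take j).flatMap φ) ++ (φ x ++
        ((u.drop (j + 1)).flatMap φ ++ s)) := by
      rw [← hps, hrest (j + 1), hstep j x hj]
      simp
    have hn := hle (j + 1)
    rw [hstep j x hj, List.length_append] at hn
    have h1 : ((List.range n).map c)[p.length + ((u.take j).flatMap φ).length + i]? =
        some (c (p.length + ((u.take j).flatMap φ).length + i)) := by
      rw [List.getElem?_map, List.getElem?_range (by omega)]
      rfl
    rw [e, List.getElem?_append_right (by simp), List.getElem?_append_left (by simpa using hi)] at h1
    simp only [List.length_append, Nat.add_sub_cancel_left] at h1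
    rw [List.getElem?_eq_getElem hi] at h1
    exact (Option.some.inj h1).symm
  refine ⟨fun j => p.length + ((u.take j).flatMap φ).length, ?_, ?_⟩
  · intro j j' x hj hj'
    refine ⟨(φ x).length, ?_, ?_, fun i hi => ?_⟩
    · simp only [hstep j x hj, List.length_append, add_assoc]
    · simp only [hstep j' x hj', List.length_append, add_assoc]
    · rw [hchar j x hj i hi, hchar j' x hj' i hi]
  · intro j hj
    refine ⟨?_, hle _⟩
    have := List.length_pos_of_ne_nil (hφ u[j] (List.getElem_mem hj))
    simp only [hstep j u[j] (List.getElem?_eq_getElem hj), List.length_append]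
    omega

theorem not_containsValue_iterWord {V : Type*} {u : List V} (hu : ¬ IsBlocking u) {k : ℕ}
    (hk : 0 < k) (hk4 : 4 ∣ k) (hk8 : 8 ≤ k) (hα : 2 * numLetters u + 2 ≤ k)
    (σ : Equiv.Perm (Fin k)) (m : ℕ) :
    ¬ ContainsValue u (iterWord hk (fun i => permList k (σ i)) m) := by
  intro h
  rw [iterWord_eq] at h
  obtain ⟨B, hB, hlive⟩ := exists_parse_of_containsValue h
  obtain ⟨R, hR, hs⟩ := exists_ruler_parse hk hk4 hk8 hα σ m B hB (fun j hj _ => (hlive j hj).2)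
  exact hu (hR.isBlocking fun j hj => (hs j hj).2 (hlive j hj).1)

/-! ### Patterns with one letter, and the conclusion -/

/-- A square-free infinite word on four letters: the letter in position `n` records the parity of
`n` and the residue modulo `4` of the odd part of `n`. -/
def oddPartText (n : ℕ) : Fin 4 :=
  ⟨2 * (n % 2) + n / 2 ^ padicValNat 2 n % 4 / 2, by omega⟩

theorem oddPartText_two_pow_mul (e b : ℕ) :
    (oddPartText (2 ^ e * (2 * b + 1))).val = 2 * (2 ^ e * (2 * b + 1) % 2) + b % 2 := by
  have hb : padicValNat 2 (2 * b + 1) = 0 := padicValNat.eq_zero_of_not_dvd (by omega)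
  unfold oddPartText
  dsimp only
  rw [padicValNat_two_pow_mul (by omega), hb, add_zero, Nat.mul_div_cancel_left _ (by positivity)]
  omega

/-- For odd l the parities differ. If 2^(s+1) exactly divides l with s ≥ 0, some number n + i with i
< l is an odd multiple of 2^s; adding l changes its odd part by 2 modulo 4. -/
theorem oddPartText_square_free (n : ℕ) {l : ℕ} (hl : 0 < l) :
    ∃ i < l, oddPartText (n + i) ≠ oddPartText (n + l + i) := by
  obtain ⟨s, r, hr, rfl⟩ := Nat.exists_eq_two_pow_mul_odd hl.ne'
  obtain ⟨p, rfl⟩ := hr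
  rcases s with _ | s
  · refine ⟨0, hl, fun h => ?_⟩
    have := congrArg Fin.val h
    simp only [oddPartText, pow_zero] at this
    omega
  · have hh := Nat.two_pow_pos s
    rw [pow_succ, mul_comm _ 2] at hl ⊢
    have hM : 2 * 2 ^ s ≤ 2 * 2 ^ s * (2 * p + 1) := Nat.le_mul_of_pos_right _ (by omega)
    have hlt : n % (2 * 2 ^ s) < 2 * 2 ^ s := Nat.mod_lt _ (by omega)
    obtain ⟨i, hi, hmod⟩ : ∃ i < 2 * 2 ^ s, (n + i) % (2 * 2 ^ s) = 2 ^ s := by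
      have hd := Nat.div_add_mod n (2 * 2 ^ s)
      rcases le_or_gt (n % (2 * 2 ^ s)) (2 ^ s) with h | h
      · refine ⟨2 ^ s - n % (2 * 2 ^ s), by omega, ?_⟩
        rw [show n + (2 ^ s - n % (2 * 2 ^ s)) = 2 * 2 ^ s * (n / (2 * 2 ^ s)) + 2 ^ s by omega,
          Nat.mul_add_mod, Nat.mod_eq_of_lt (by omega)]
      · refine ⟨3 * 2 ^ s - n % (2 * 2 ^ s), by omega, ?_⟩
        rw [show n + (3 * 2 ^ s - n % (2 * 2 ^ s)) =
            2 * 2 ^ s * (n / (2 * 2 ^ s) + 1) + 2 ^ s by rw [mul_add]; omega,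
          Nat.mul_add_mod, Nat.mod_eq_of_lt (by omega)]
    refine ⟨i, by omega, fun h => ?_⟩
    have hd := Nat.div_add_mod (n + i) (2 * 2 ^ s)
    rw [hmod] at hd
    generalize (n + i) / (2 * 2 ^ s) = g at hd
    have e1 : n + i = 2 ^ s * (2 * g + 1) := by rw [← hd]; ring
    have e2 : n + 2 * 2 ^ s * (2 * p + 1) + i = 2 ^ s * (2 * (g + 2 * p + 1) + 1) := by
      rw [add_right_comm, e1]; ring
    have e3 : 2 ^ s * (2 * (g + 2 * p + 1) + 1) % 2 = 2 ^ s * (2 * g + 1) % 2 := by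
      rw [← e2, ← e1, mul_assoc]; omega
    have := congrArg Fin.val h
    rw [e1, e2, oddPartText_two_pow_mul, oddPartText_two_pow_mul, e3] at this
    omega

theorem isBlocking_nil {V : Type*} : IsBlocking ([] : List V) := by
  intro A _
  convert Set.finite_empty
  ext w
  simp only [Set.mem_ofPred_eq, Set.mem_empty_iff_false, iff_false, not_not]
  exact ⟨fun _ => [], by simp, by simp⟩

theorem isBlocking_singleton {V : Type*} (x : V) : IsBlocking [x] := by
  refine IsParse.isBlocking (R := id) (fun j j' y hj hj' => ⟨1, rfl, rfl, ?_⟩) (fun j _ => by simp)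
  have h1 := (List.getElem?_eq_some_iff.1 hj).1
  have h2 := (List.getElem?_eq_some_iff.1 hj').1
  simp only [List.length_singleton, Nat.lt_one_iff] at h1 h2
  subst h1 h2
  simp

theorem one_le_numLetters {V : Type*} {u : List V} (hu : ¬ IsBlocking u) : 1 ≤ numLetters u := by
  by_contra h
  have h0 : {x | x ∈ u} = ∅ := by
    rw [← Set.ncard_eq_zero (List.finite_toSet u)]
    unfold numLetters at h
    omega
  have : u = [] := List.eq_nil_iff_forall_not_mem.2 fun x hx => by
    have : x ∈ {x | x ∈ u} := hx
    simp [h0] at this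
  exact hu (this ▸ isBlocking_nil)

/-- A non-blocking word on one letter has length at least 2, so each of its values contains a
square. -/
theorem isAvoidableOn_four {V : Type*} {u : List V} (hu : ¬ IsBlocking u) (h1 : numLetters u = 1) :
    IsAvoidableOn u 4 := by
  obtain ⟨a, ha⟩ := Set.ncard_eq_one.1 h1
  have hmem : ∀ x ∈ u, x = a := fun x hx => by
    have : x ∈ {x | x ∈ u} := hx
    simpa [ha] using this
  match u, hmem with
  | [], _ => exact absurd isBlocking_nil hu
  | [x], _ => exact absurd (isBlocking_singleton x) hu
  | x :: y :: u, hmem =>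
    have hxy : x = y := (hmem x (by simp)).trans (hmem y (by simp)).symm
    subst hxy
    refine Set.infinite_of_injective_forall_mem
      (f := fun n : ℕ => (List.range n).map oddPartText) (fun n n' h => ?_) (fun n hn => ?_)
    · simpa using congrArg List.length h
    · obtain ⟨B, hB, hlive⟩ := exists_parse_of_containsValue hn
      obtain ⟨l, e1, -, e3⟩ := hB 0 1 x (by simp) (by simp)
      have := (hlive 0 (by simp)).1
      obtain ⟨i, hi, hne⟩ := oddPartText_square_free (B 0) (l := l) (by omega)
      have h := e3 i hi
      rw [zero_add] at e1
      rw [e1] at h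
      exact hne h

theorem isAvoidableOn_of_dvd {V : Type*} {u : List V} (hu : ¬ IsBlocking u) {k : ℕ} (hk4 : 4 ∣ k)
    (hk : k = 2 * numLetters u + 2 ∨ k = 2 * numLetters u + 4) : IsAvoidableOn u k := by
  have h1 := one_le_numLetters hu
  rcases h1.eq_or_lt with h | h
  · obtain rfl : k = 4 := by omega
    exact isAvoidableOn_four hu h.symm
  · have hk0 : 0 < k := by omega
    refine Set.infinite_of_injective_forall_mem
      (f := fun m : ℕ => iterWord hk0 (fun i => permList k ((1 : Equiv.Perm (Fin k)) i)) m)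
      (fun m m' e => ?_) (fun m => not_containsValue_iterWord hu hk0 hk4 (by omega) (by omega) 1 m)
    have e := congrArg List.length e
    simp only [iterWord_eq, List.length_map, List.length_range] at e
    exact Nat.pow_right_injective (by omega) e

theorem mainTheorem1 {V : Type*} (u : List V) (hu : ¬ IsBlocking u) :
    minAlphabet u ≤ 2 * numLetters u + 4 ∧
    (∀ (k : ℕ) (hk : 0 < k), 4 ∣ k → (k = 2 * numLetters u + 2 ∨ k = 2 * numLetters u + 4) →
      IsAvoidableOn u k ∧
      (2 ≤ numLetters u → ∀ (σ : Equiv.Perm (Fin k)) (m : ℕ), 1 ≤ m →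
        ¬ ContainsValue u (iterWord hk (fun i => permList k (σ i)) m))) ∧
    2 * numLetters u + 4 < 4 * (numLetters u + 2) * ⌊Real.log ((numLetters u : ℝ) + 2)⌋₊ ∧
    2 * numLetters u + 4 < 9 * (numLetters u + 20) := by
  have h1 := one_le_numLetters hu
  refine ⟨?_, fun k hk hk4 hkα => ⟨isAvoidableOn_of_dvd hu hk4 hkα, fun h2 σ m _ =>
    not_containsValue_iterWord hu hk hk4 (by omega) (by omega) σ m⟩, ?_, by omega⟩
  · rcases Nat.even_or_odd' (numLetters u) with ⟨c, hc | hc⟩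
    · exact Nat.sInf_le (isAvoidableOn_of_dvd hu (by omega) (Or.inr rfl))
    · exact (Nat.sInf_le (isAvoidableOn_of_dvd hu (by omega) (Or.inl rfl))).trans (by omega)
  -- As α(u) ≥ 1 and e < 3, the logarithm is at least 1.
  · have hfl : 1 ≤ ⌊Real.log ((numLetters u : ℝ) + 2)⌋₊ := by
      apply Nat.le_floor
      have h1' : (1 : ℝ) ≤ numLetters u := by exact_mod_cast h1
      rw [Nat.cast_one, Real.le_log_iff_exp_le (by linarith)]
      have := Real.exp_one_lt_d9
      linarith
    have := Nat.mul_le_mul_left (4 * (numLetters u + 2)) hfl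
    omega
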